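/- Let $P_1,P_2,Q\ge 0$. Consider the memoryless channel $Y=X_1+X_2+S+Z$ with state $S\sim\mathcal N(0,Q)$ and noise $Z\sim\mathcal N(0,1)$, where $S$ and $Z$ are independent of each other and i.i.d. over channel uses. A code of length $n$ with message sets $\{1,\dots,N_1\}$, $\{1,\dots,N_2\}$ consists of (measurable) maps $x_1^n(m_1,s^n)$, $x_2^n(m_2)$ and a decoder $y^n\mapsto(\hat m_1,\hat m_2)$; so encoder 1 knows its message and the whole state sequence, encoder 2 only its own message, and the decoder only the output sequence. With $M_1,M_2$ independent, uniform, and independent of $(S^n,Z^n)$, the code must satisfy $\sum_{i=1}^n\mathbb E[X_{1,i}^2(M_1,S^n)]\le nP_1$ and $\sum_{i=1}^n\mathbb E[X_{2,i}^2(M_2)]\le nP_2$, and its error probability is $\mathbb P[(\hat M_1,\hat M_2)\ne(M_1,M_2)]$. A pair $(R_1,R_2)$ of nonnegative rates is achievable if there are such codes for every $n$ with $N_1\ge e^{nR_1}$, $N_2\ge e^{nR_2}$ and error probability tending to $0$ as $n\to\infty$. The capacity region $\mathcal C(P_1,P_2,Q)$ (without degraded message sets) is the closure of the set of achievable pairs.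 Then for every $(R_1,R_2)\in\mathcal C(P_1,P_2,Q)$ there is a joint law of $(S,X_1,X_2)$ of the form $P_SP_{X_1|S}P_{X_2}$ with $P_S=\mathcal N(0,Q)$, $\mathbb E[X_1^2]\le P_1$ and $\mathbb E[X_2^2]\le P_2$, such that, with $Y=X_1+X_2+S+Z$ and $Z\sim\mathcal N(0,1)$ independent of $(S,X_1,X_2)$, $$R_1\le I(X_1;Y\mid X_2,S),\qquad R_2\le I(X_2;Y\mid X_1,S),\qquad R_1+R_2\le I(X_1;Y\mid X_2,S)+I(X_2;Y),$$ where mutual information is measured in nats. -/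

import Mathlib

open MeasureTheory ProbabilityTheory InformationTheory Filter Topology
open scoped NNReal ENNReal

noncomputable section

namespace DirtyMAC

/-- Mutual information `I(X;Y)` in nats: the relative entropy between the joint law of `(X, Y)` and
the product of the marginal laws. -/
def mutualInfo {Ω α β : Type*} [MeasurableSpace Ω] [MeasurableSpace α] [MeasurableSpace β]
    (X : Ω → α) (Y : Ω → β) (μ : Measure Ω) : ℝ≥0∞ :=
  klDiv (μ.map fun ω => (X ω, Y ω)) ((μ.map X).prod (μ.map Y))

/-- Conditional mutual information `I(X;Y|W)` in nats: the relative entropy between the joint law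
`P_{W,X,Y}` and `P_W P_{X|W} P_{Y|W}`. -/
def condMutualInfo {Ω α β γ : Type*} [MeasurableSpace Ω]
    [MeasurableSpace α] [StandardBorelSpace α] [Nonempty α]
    [MeasurableSpace β] [StandardBorelSpace β] [Nonempty β] [MeasurableSpace γ]
    (X : Ω → α) (Y : Ω → β) (W : Ω → γ) (μ : Measure Ω) [IsFiniteMeasure μ] : ℝ≥0∞ :=
  klDiv (μ.map fun ω => (W ω, X ω, Y ω))
    ((μ.map W) ⊗ₘ (condDistrib X W μ ×ₖ condDistrib Y W μ))

/-- A block code of length `n` with message sets `Fin N₁`, `Fin N₂` (without degraded message sets).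
Encoder 1 knows its message and the whole state sequence, encoder 2 only its own message, and the
decoder only the channel output sequence. -/
structure Code (n N₁ N₂ : ℕ) where
  enc₁ : Fin N₁ → (Fin n → ℝ) → Fin n → ℝ
  measurable_enc₁ : ∀ m, Measurable (enc₁ m)
  enc₂ : Fin N₂ → Fin n → ℝ
  dec : (Fin n → ℝ) → Fin N₁ × Fin N₂
  measurable_dec : Measurable dec

/-- Sample space of one block transmission: the messages `(M₁, M₂)`, then the state sequence `Sⁿ`
and the noise sequence `Zⁿ`. -/
abbrev Sample (n N₁ N₂ : ℕ) : Type :=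
  (Fin N₁ × Fin N₂) × ((Fin n → ℝ) × (Fin n → ℝ))

/-- Law of `((M₁, M₂), (Sⁿ, Zⁿ))`: all four are independent, the messages are uniform, the state is
i.i.d. `N(0, Q)` and the noise is i.i.d. `N(0, 1)`. -/
def blockLaw (n N₁ N₂ : ℕ) (Q : ℝ≥0) : Measure (Sample n N₁ N₂) :=
  ((uniformOn (Set.univ : Set (Fin N₁))).prod (uniformOn (Set.univ : Set (Fin N₂)))).prod
    ((Measure.pi fun _ : Fin n => gaussianReal 0 Q).prod
      (Measure.pi fun _ : Fin n => gaussianReal 0 1))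

namespace Code

variable {n N₁ N₂ : ℕ}

/-- The channel input sequence of encoder 1. -/
def input₁ (c : Code n N₁ N₂) (ω : Sample n N₁ N₂) : Fin n → ℝ := c.enc₁ ω.1.1 ω.2.1

/-- The channel input sequence of encoder 2. -/
def input₂ (c : Code n N₁ N₂) (ω : Sample n N₁ N₂) : Fin n → ℝ := c.enc₂ ω.1.2

/-- The channel output sequence `Yᵢ = X₁ᵢ + X₂ᵢ + Sᵢ + Zᵢ`. -/
def output (c : Code n N₁ N₂) (ω : Sample n N₁ N₂) : Fin n → ℝ :=
  fun i => c.input₁ ω i + c.input₂ ω i + ω.2.1 i + ω.2.2 i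

/-- The average power constraints `∑ᵢ E[X₁ᵢ²] ≤ n P₁` and `∑ᵢ E[X₂ᵢ²] ≤ n P₂`. -/
def SatisfiesPower (c : Code n N₁ N₂) (P₁ P₂ Q : ℝ≥0) : Prop :=
  ∑ i, ∫⁻ ω, ENNReal.ofReal (c.input₁ ω i ^ 2) ∂(blockLaw n N₁ N₂ Q) ≤ n * P₁ ∧
  ∑ i, ∫⁻ ω, ENNReal.ofReal (c.input₂ ω i ^ 2) ∂(blockLaw n N₁ N₂ Q) ≤ n * P₂

/-- The average probability that the decoded message pair differs from the transmitted one. -/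
def errorProb (c : Code n N₁ N₂) (Q : ℝ≥0) : ℝ≥0∞ :=
  blockLaw n N₁ N₂ Q {ω | c.dec (c.output ω) ≠ ω.1}

end Code

/-- A rate pair (in nats per channel use) is achievable if there are codes of all block lengths `n`,
with at least `exp (n R₁)` and `exp (n R₂)` messages, that satisfy the power constraints and whose
average error probability tends to zero. -/
def Achievable (P₁ P₂ Q : ℝ≥0) (R₁ R₂ : ℝ) : Prop :=
  0 ≤ R₁ ∧ 0 ≤ R₂ ∧
  ∃ (N₁ N₂ : ℕ → ℕ) (c : ∀ n, Code n (N₁ n) (N₂ n)),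
    (∀ n : ℕ, Real.exp (n * R₁) ≤ N₁ n ∧ Real.exp (n * R₂) ≤ N₂ n ∧
      (c n).SatisfiesPower P₁ P₂ Q) ∧
    Tendsto (fun n => (c n).errorProb Q) atTop (𝓝 0)

/-- The capacity region: the closure of the set of achievable rate pairs. -/
def capacityRegion (P₁ P₂ Q : ℝ≥0) : Set (ℝ × ℝ) :=
  closure {R | Achievable P₁ P₂ Q R.1 R.2}

/-- The law of `(S, X₁, X₂, Z)` for a single channel use with joint input law `P_S P_{X₁|S} P_{X₂}`,
where `S ∼ N(0, Q)`, `P_{X₁|S} = κ`, `P_{X₂} = ν`, and the noise `Z ∼ N(0, 1)` is independent of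
`(S, X₁, X₂)`. -/
def letterLaw (Q : ℝ≥0) (κ : Kernel ℝ ℝ) (ν : Measure ℝ) : Measure (((ℝ × ℝ) × ℝ) × ℝ) :=
  (((gaussianReal 0 Q) ⊗ₘ κ).prod ν).prod (gaussianReal 0 1)

instance (Q : ℝ≥0) (κ : Kernel ℝ ℝ) [IsMarkovKernel κ] (ν : Measure ℝ) [IsProbabilityMeasure ν] :
    IsProbabilityMeasure (letterLaw Q κ ν) := by
  unfold letterLaw; infer_instance

/-- The state `S` of a single channel use. -/
def state (ω : ((ℝ × ℝ) × ℝ) × ℝ) : ℝ := ω.1.1.1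

/-- The input `X₁` of a single channel use. -/
def inp₁ (ω : ((ℝ × ℝ) × ℝ) × ℝ) : ℝ := ω.1.1.2

/-- The input `X₂` of a single channel use. -/
def inp₂ (ω : ((ℝ × ℝ) × ℝ) × ℝ) : ℝ := ω.1.2

/-- The noise `Z` of a single channel use. -/
def noise (ω : ((ℝ × ℝ) × ℝ) × ℝ) : ℝ := ω.2

/-- The output `Y = X₁ + X₂ + S + Z` of a single channel use. -/
def out (ω : ((ℝ × ℝ) × ℝ) × ℝ) : ℝ := inp₁ ω + inp₂ ω + state ω + noise ω

/-- The single-letter region: rate pairs for which some joint law `P_S P_{X₁|S} P_{X₂}` obeying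
`E[X₁²] ≤ P₁` and `E[X₂²] ≤ P₂` satisfies all three mutual information bounds. -/
def outerRegion (P₁ P₂ Q : ℝ≥0) : Set (ℝ × ℝ) :=
  {R | 0 ≤ R.1 ∧ 0 ≤ R.2 ∧
    ∃ (κ : Kernel ℝ ℝ) (_ : IsMarkovKernel κ) (ν : Measure ℝ) (_ : IsProbabilityMeasure ν),
      ∫⁻ ω, ENNReal.ofReal (inp₁ ω ^ 2) ∂(letterLaw Q κ ν) ≤ P₁ ∧
      ∫⁻ ω, ENNReal.ofReal (inp₂ ω ^ 2) ∂(letterLaw Q κ ν) ≤ P₂ ∧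
      ENNReal.ofReal R.1 ≤
        condMutualInfo inp₁ out (fun ω => (inp₂ ω, state ω)) (letterLaw Q κ ν) ∧
      ENNReal.ofReal R.2 ≤
        condMutualInfo inp₂ out (fun ω => (inp₁ ω, state ω)) (letterLaw Q κ ν) ∧
      ENNReal.ofReal (R.1 + R.2) ≤
        condMutualInfo inp₁ out (fun ω => (inp₂ ω, state ω)) (letterLaw Q κ ν) +
          mutualInfo inp₂ out (letterLaw Q κ ν)}

end DirtyMAC

end

/-! Everything passes through an explicit Gaussian region, `gaussRegion`, indexed by the correlation
ρ between X₁ and the normalized state T, where S = √Q·T. The capacity region lies inside it, and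
each of its points with nonnegative rates is covered by Gaussian inputs.

Converse: instead of Fano's inequality and entropies, the true law of (Tⁿ, Yⁿ) given the messages is
compared with a Gaussian reference law under which the decoder succeeds with average probability at
most 1/N. Then (success probability)·log N is at most the divergence between the two laws plus one
nat (`measureReal_mul_log_le`, `success_mul_log_le`). Three references give the three bounds: (1) T
standard and Y centred at (ρ + √Q)T + x₂, which ignores M₁; (2) T standard and Y centred at x₁ +
√Q·T, which ignores M₂; (3) Y Gaussian with a fixed mean, and T estimated linearly from Y − x₂, so
that the law of Y ignores both messages. The divergences involve only second moments of the block,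
hence only the power and one averaged correlation ρ (`Code.exists_correlation`): no
single-letterization by time sharing is needed. Since ρ ranges over a compact interval, the region
is closed (`isClosed_gaussRegion`), so the limit n → ∞ and the closure cost nothing.

Direct part: for X₁ = aS + N(0, τ) with a = ρ/√Q, τ = P₁ − ρ², and X₂ ∼ N(0, P₂), every relevant
conditional law of Y is Gaussian, and each information is at least half the log-ratio of two
variances (`le_klDiv_compProd_gaussKernel`). -/

noncomputable section

namespace DirtyMAC

/-! ### Change-of-measure inequality. -/

/-- If `exp ℓ` is a sub-probability density with respect to `μ` which gives mass at most `1 / N` to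
the event `A`, then `μ A * log N` exceeds the divergence `E[-ℓ]` by at most one nat. -/
lemma measureReal_mul_log_le {Ω : Type*} [MeasurableSpace Ω] {μ : Measure Ω}
    [IsProbabilityMeasure μ] {ℓ : Ω → ℝ} (hℓm : Measurable ℓ) (hℓ : Integrable ℓ μ) {A : Set Ω}
    (hA : MeasurableSet A) {N : ℝ} (hN : 1 ≤ N)
    (h1 : ∫⁻ ω, ENNReal.ofReal (Real.exp (ℓ ω)) ∂μ ≤ 1)
    (h2 : ENNReal.ofReal N * ∫⁻ ω in A, ENNReal.ofReal (Real.exp (ℓ ω)) ∂μ ≤ 1) :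
    μ.real A * Real.log N ≤ -∫ ω, ℓ ω ∂μ + 1 := by
  have hN0 : 0 < N := by linarith
  have hexp : Integrable (fun ω => Real.exp (ℓ ω)) μ := by
    refine ⟨(Real.measurable_exp.comp hℓm).aestronglyMeasurable, ?_⟩
    rw [hasFiniteIntegral_iff_ofReal (ae_of_all _ fun ω => (Real.exp_pos _).le)]
    exact h1.trans_lt ENNReal.one_lt_top
  have hle1 : ∫ ω, Real.exp (ℓ ω) ∂μ ≤ 1 := by
    rw [integral_eq_lintegral_of_nonneg_ae (ae_of_all _ fun ω => (Real.exp_pos _).le)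
      hexp.aestronglyMeasurable]
    exact ENNReal.toReal_le_of_le_ofReal zero_le_one (by simpa using h1)
  have hle2 : N * ∫ ω in A, Real.exp (ℓ ω) ∂μ ≤ 1 := by
    rw [integral_eq_lintegral_of_nonneg_ae (ae_of_all _ fun ω => (Real.exp_pos _).le)
      hexp.integrableOn.aestronglyMeasurable, ← ENNReal.toReal_ofReal hN0.le,
      ← ENNReal.toReal_mul]
    exact ENNReal.toReal_le_of_le_ofReal zero_le_one (by simpa using h2)
  -- The inequality 1 + u ≤ exp u is used at u = ℓ + log N on A and at u = ℓ off A.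
  have hpt : ∀ ω, ℓ ω + A.indicator (fun _ => Real.log N) ω ≤
      A.indicator (fun ω => N * Real.exp (ℓ ω)) ω + Real.exp (ℓ ω) - 1 := by
    intro ω
    by_cases hω : ω ∈ A
    · simp only [Set.indicator_of_mem hω]
      have h := Real.add_one_le_exp (ℓ ω + Real.log N)
      rw [Real.exp_add, Real.exp_log hN0] at h
      linarith [Real.exp_pos (ℓ ω)]
    · simp only [Set.indicator_of_notMem hω]
      linarith [Real.add_one_le_exp (ℓ ω)]
  have hi1 : Integrable (A.indicator fun _ => Real.log N) μ := (integrable_const _).indicator hA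
  have hi2 : Integrable (A.indicator fun ω => N * Real.exp (ℓ ω)) μ :=
    (hexp.const_mul N).indicator hA
  -- After integration the right side is at most 1 + 1 − 1, which is the one nat lost.
  have h := integral_mono (hℓ.add hi1) ((hi2.add hexp).sub (integrable_const (1 : ℝ))) hpt
  rw [integral_add' hℓ hi1, integral_sub' (hi2.add hexp) (integrable_const _),
    integral_add' hi2 hexp, integral_indicator hA, integral_indicator hA, integral_const_mul,
    setIntegral_const, integral_const, smul_eq_mul] at h
  simp only [probReal_univ, smul_eq_mul, mul_one] at h
  linarith

/-! ### Densities of Gaussian vectors. -/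

/-- Logarithm of the density of a Gaussian vector with mean `m` and covariance `v • 1`. -/
def logGauss {n : ℕ} (v : ℝ) (m u : Fin n → ℝ) : ℝ :=
  ∑ i, (-(Real.log (2 * Real.pi * v) / 2) - (u i - m i) ^ 2 / (2 * v))

@[fun_prop]
lemma measurable_logGauss {n : ℕ} (v : ℝ) {α : Type*} [MeasurableSpace α] {m u : α → Fin n → ℝ}
    (hm : Measurable m) (hu : Measurable u) : Measurable fun a => logGauss v (m a) (u a) := by
  unfold logGauss
  fun_prop

lemma gaussianPDF_eq_exp {v : ℝ≥0} (hv : v ≠ 0) (m x : ℝ) :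
    gaussianPDF m v x = ENNReal.ofReal
      (Real.exp (-(Real.log (2 * Real.pi * v) / 2) - (x - m) ^ 2 / (2 * v))) := by
  have hv' : (0 : ℝ) < v := NNReal.coe_pos.2 (pos_iff_ne_zero.2 hv)
  have h2 : 0 < 2 * Real.pi * v := by positivity
  rw [gaussianPDF, gaussianPDFReal, sub_eq_add_neg (-_), Real.exp_add, Real.exp_neg,
    Real.sqrt_eq_rpow, Real.rpow_def_of_pos h2, neg_div]
  congr 4
  ring

lemma lintegral_pi_prod {n : ℕ} {μ : Fin n → Measure ℝ} [∀ i, SigmaFinite (μ i)]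
    {f : Fin n → ℝ → ℝ≥0∞} (hf : ∀ i, Measurable (f i)) :
    ∫⁻ x, ∏ i, f i (x i) ∂(Measure.pi μ) = ∏ i, ∫⁻ x, f i x ∂(μ i) := by
  induction n with
  | zero => simp
  | succ n ih =>
    rw [← ((measurePreserving_piFinSuccAbove μ 0).symm).lintegral_comp (by fun_prop)]
    simp_rw [MeasurableEquiv.piFinSuccAbove_symm_apply, Fin.insertNthEquiv,
      Fin.prod_univ_succ, Fin.insertNth_zero, Equiv.coe_fn_mk, Fin.cons_succ,
      Fin.zero_succAbove, Fin.cons_zero]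
    rw [← ih (fun i => hf i.succ), ← lintegral_prod_mul (hf 0).aemeasurable
      (Finset.measurable_prod _ fun i _ => (hf i.succ).comp (measurable_pi_apply i)).aemeasurable]
    rfl

lemma pi_gaussianReal_eq_withDensity {n : ℕ} {v : ℝ≥0} (hv : v ≠ 0) (m : Fin n → ℝ) :
    Measure.pi (fun i => gaussianReal (m i) v) =
      volume.withDensity fun u => ENNReal.ofReal (Real.exp (logGauss v m u)) := by
  refine (Measure.pi_eq (μ := fun i => gaussianReal (m i) v) fun s hs => ?_)
  rw [withDensity_apply _ (MeasurableSet.univ_pi hs), volume_pi, Measure.restrict_pi_pi]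
  simp_rw [logGauss, Real.exp_sum, ENNReal.ofReal_prod_of_nonneg
    (fun i _ => (Real.exp_pos _).le), ← gaussianPDF_eq_exp hv]
  rw [lintegral_pi_prod fun i => measurable_gaussianPDF (m i) v]
  simp_rw [gaussianReal_apply _ hv]

lemma lintegral_exp_logGauss {n : ℕ} {v : ℝ} (hv : 0 < v) (m : Fin n → ℝ) :
    ∫⁻ u, ENNReal.ofReal (Real.exp (logGauss v m u)) = 1 := by
  lift v to ℝ≥0 using hv.le
  have h := congrArg (fun ν => ν Set.univ) (pi_gaussianReal_eq_withDensity
    (v := v) (fun h => by simp [h] at hv) m)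
  simpa using h.symm

/-- Law of a vector of `n` independent standard Gaussian variables. -/
def stdGauss (n : ℕ) : Measure (Fin n → ℝ) := Measure.pi fun _ => gaussianReal 0 1

instance (n : ℕ) : IsProbabilityMeasure (stdGauss n) := by unfold stdGauss; infer_instance

lemma stdGauss_eq_withDensity (n : ℕ) :
    stdGauss n = volume.withDensity fun u => ENNReal.ofReal (Real.exp (logGauss 1 0 u)) := by
  simpa [stdGauss] using pi_gaussianReal_eq_withDensity (n := n) one_ne_zero 0

lemma lintegral_stdGauss {n : ℕ} (f : (Fin n → ℝ) → ℝ≥0∞) (hf : Measurable f) :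
    ∫⁻ u, f u ∂(stdGauss n) = ∫⁻ u, ENNReal.ofReal (Real.exp (logGauss 1 0 u)) * f u := by
  rw [stdGauss_eq_withDensity, lintegral_withDensity_eq_lintegral_mul _ (by fun_prop) hf]
  rfl

/-- Change of variables `y = x t + z` for a density relative to the law of the Gaussian pair
`(t, z)`. -/
lemma lintegral_stdGauss_change {n : ℕ} {x : (Fin n → ℝ) → Fin n → ℝ} (hx : Measurable x)
    {L : (Fin n → ℝ) → (Fin n → ℝ) → ℝ} (hL : Measurable (Function.uncurry L))
    {F : (Fin n → ℝ) → ℝ≥0∞} (hF : Measurable F) :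
    ∫⁻ t, ∫⁻ z, ENNReal.ofReal (Real.exp (L t (x t + z) - logGauss 1 0 t - logGauss 1 0 z)) *
        F (x t + z) ∂(stdGauss n) ∂(stdGauss n) =
      ∫⁻ t, ∫⁻ y, ENNReal.ofReal (Real.exp (L t y)) * F y := by
  have hL' : ∀ {α : Type} [MeasurableSpace α] {f g : α → Fin n → ℝ}, Measurable f →
      Measurable g → Measurable fun a => L (f a) (g a) := fun hf hg => hL.comp (hf.prodMk hg)
  have hm : Measurable fun p : (Fin n → ℝ) × (Fin n → ℝ) => ENNReal.ofReal
      (Real.exp (L p.1 (x p.1 + p.2) - logGauss 1 0 p.1 - logGauss 1 0 p.2)) *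
        F (x p.1 + p.2) := by
    have := hL' (α := (Fin n → ℝ) × (Fin n → ℝ)) (f := fun p => p.1) (g := fun p => x p.1 + p.2)
      (by fun_prop) (by fun_prop)
    fun_prop
  rw [lintegral_stdGauss _ hm.lintegral_prod_right']
  refine lintegral_congr fun t => ?_
  have hmt := hm.comp (measurable_prodMk_left (x := t))
  simp only [Function.comp_def] at hmt
  rw [lintegral_stdGauss _ hmt, ← lintegral_const_mul _ (by fun_prop)]
  rw [← lintegral_add_left_eq_self (fun y => ENNReal.ofReal (Real.exp (L t y)) * F y) (x t)]
  refine lintegral_congr fun z => ?_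
  rw [← mul_assoc, ← mul_assoc, ← ENNReal.ofReal_mul (Real.exp_pos _).le,
    ← ENNReal.ofReal_mul (by positivity), ← Real.exp_add, ← Real.exp_add]
  congr 3
  ring

/-! ### Normalized model and its moments. -/

/-- Law of `((M₁, M₂), (Tⁿ, Zⁿ))` with uniform messages and standard Gaussian vectors `Tⁿ` and `Zⁿ`,
all independent. -/
def stdLaw (n N₁ N₂ : ℕ) : Measure (Sample n N₁ N₂) :=
  ((uniformOn (Set.univ : Set (Fin N₁))).prod (uniformOn (Set.univ : Set (Fin N₂)))).prod
    ((stdGauss n).prod (stdGauss n))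

instance (n N₁ N₂ : ℕ) [NeZero N₁] [NeZero N₂] : IsProbabilityMeasure (stdLaw n N₁ N₂) := by
  unfold stdLaw; infer_instance

lemma lintegral_uniformOn_univ {N : ℕ} (g : Fin N → ℝ≥0∞) :
    ∫⁻ m, g m ∂(uniformOn (Set.univ : Set (Fin N))) = (N : ℝ≥0∞)⁻¹ * ∑ m, g m := by
  rw [uniformOn, ProbabilityTheory.cond, Measure.restrict_univ, lintegral_smul_measure,
    lintegral_count,
    tsum_fintype]
  simp

lemma lintegral_stdLaw {n N₁ N₂ : ℕ} {f : Sample n N₁ N₂ → ℝ≥0∞} (hf : Measurable f) :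
    ∫⁻ ω, f ω ∂(stdLaw n N₁ N₂) = (N₁ : ℝ≥0∞)⁻¹ * (N₂ : ℝ≥0∞)⁻¹ *
      ∑ m, ∫⁻ t, ∫⁻ z, f (m, (t, z)) ∂(stdGauss n) ∂(stdGauss n) := by
  rw [stdLaw, lintegral_prod _ hf.aemeasurable, lintegral_prod _ (by fun_prop),
    lintegral_uniformOn_univ]
  simp_rw [lintegral_uniformOn_univ]
  rw [← Finset.mul_sum, ← mul_assoc, Fintype.sum_prod_type]
  refine congrArg _ (Finset.sum_congr rfl fun m₁ _ => Finset.sum_congr rfl fun m₂ _ => ?_)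
  exact lintegral_prod _ (hf.comp measurable_prodMk_left).aemeasurable

lemma measurable_sample {n N₁ N₂ : ℕ} {β : Type*} [MeasurableSpace β] {f : Sample n N₁ N₂ → β}
    (h : ∀ m, Measurable fun p => f (m, p)) : Measurable f :=
  measurable_from_prod_countable_right h

section Moments

variable {Ω : Type*} [MeasurableSpace Ω] {μ : Measure Ω} [IsProbabilityMeasure μ] {n : ℕ}

lemma integrable_logGauss (v : ℝ) {m u : Ω → Fin n → ℝ}
    (h : ∀ i, MemLp (fun ω => u ω i - m ω i) 2 μ) :
    Integrable (fun ω => logGauss v (m ω) (u ω)) μ :=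
  integrable_finsetSum _ fun i _ => (integrable_const _).sub ((h i).integrable_sq.div_const _)

lemma integral_logGauss (v : ℝ) {m u : Ω → Fin n → ℝ}
    (h : ∀ i, MemLp (fun ω => u ω i - m ω i) 2 μ) :
    ∫ ω, logGauss v (m ω) (u ω) ∂μ = -(n * (Real.log (2 * Real.pi * v) / 2)) -
      (∑ i, ∫ ω, (u ω i - m ω i) ^ 2 ∂μ) / (2 * v) := by
  unfold logGauss
  have hi : ∀ i, Integrable (fun ω => -(Real.log (2 * Real.pi * v) / 2) -
      (u ω i - m ω i) ^ 2 / (2 * v)) μ := fun i =>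
    (integrable_const _).sub ((h i).integrable_sq.div_const _)
  rw [integral_finsetSum _ fun i _ => hi i]
  simp_rw [integral_sub (integrable_const _) ((h _).integrable_sq.div_const _), integral_const,
    integral_div]
  simp [Finset.sum_sub_distrib, Finset.sum_div]

end Moments

section Standard

variable {n N₁ N₂ : ℕ} [NeZero N₁] [NeZero N₂]

lemma measurePreserving_fst_apply (i : Fin n) :
    MeasurePreserving (fun ω : Sample n N₁ N₂ => ω.2.1 i) (stdLaw n N₁ N₂)
      (gaussianReal 0 1) :=
  ((measurePreserving_eval (fun _ : Fin n => gaussianReal 0 1) i).comp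
    (measurePreserving_fst (μ := stdGauss n) (ν := stdGauss n))).comp measurePreserving_snd

lemma measurePreserving_snd_apply (i : Fin n) :
    MeasurePreserving (fun ω : Sample n N₁ N₂ => ω.2.2 i) (stdLaw n N₁ N₂)
      (gaussianReal 0 1) :=
  ((measurePreserving_eval (fun _ : Fin n => gaussianReal 0 1) i).comp
    (measurePreserving_snd (μ := stdGauss n) (ν := stdGauss n))).comp measurePreserving_snd

lemma integral_sq_gaussianReal (v : ℝ≥0) : ∫ x, x ^ 2 ∂(gaussianReal 0 v) = v := by
  have h := variance_of_integral_eq_zero (μ := gaussianReal 0 v) (X := id)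
    aemeasurable_id (by simp)
  rw [variance_id_gaussianReal] at h
  simpa using h.symm

section StdNormal

variable {Ω : Type*} [MeasurableSpace Ω] {μ : Measure Ω} {v : ℝ≥0} {X : Ω → ℝ}

lemma memLp_two_of_gaussian (h : MeasurePreserving X μ (gaussianReal 0 v)) : MemLp X 2 μ :=
  (memLp_id_gaussianReal' 2 (by simp)).comp_measurePreserving h

lemma integral_of_gaussian (h : MeasurePreserving X μ (gaussianReal 0 v)) :
    ∫ ω, X ω ∂μ = 0 := by
  have := integral_map (μ := μ) h.measurable.aemeasurable (f := fun x : ℝ => x) (by fun_prop)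
  rw [← this, h.map_eq, integral_id_gaussianReal]

lemma integral_sq_of_gaussian (h : MeasurePreserving X μ (gaussianReal 0 v)) :
    ∫ ω, X ω ^ 2 ∂μ = v := by
  have := integral_map (μ := μ) h.measurable.aemeasurable (f := fun x : ℝ => x ^ 2) (by fun_prop)
  rw [← this, h.map_eq, integral_sq_gaussianReal]

end StdNormal

/-! ### Converse from a reference law. -/

/-- Converse bound by comparison with a reference law of `(Tⁿ, Yⁿ)` with density `exp (L m)`, under
which the correct decision has average probability at most `1 / N`. -/
lemma success_mul_log_le {x : Fin N₁ × Fin N₂ → (Fin n → ℝ) → Fin n → ℝ}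
    (hx : ∀ m, Measurable (x m)) {dec : (Fin n → ℝ) → Fin N₁ × Fin N₂} (hdec : Measurable dec)
    {L : Fin N₁ × Fin N₂ → (Fin n → ℝ) → (Fin n → ℝ) → ℝ}
    (hL : ∀ m, Measurable (Function.uncurry (L m)))
    (hint : Integrable (fun ω => L ω.1 ω.2.1 (x ω.1 ω.2.1 + ω.2.2)) (stdLaw n N₁ N₂))
    {N : ℝ} (hN : 1 ≤ N)
    (h1 : ∀ m, ∫⁻ t, ∫⁻ y, ENNReal.ofReal (Real.exp (L m t y)) ≤ 1)
    (h2 : ENNReal.ofReal N * ∑ m, ∫⁻ t, ∫⁻ y, ENNReal.ofReal (Real.exp (L m t y)) *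
      (dec ⁻¹' {m}).indicator 1 y ≤ N₁ * N₂) :
    (stdLaw n N₁ N₂).real {ω | dec (x ω.1 ω.2.1 + ω.2.2) = ω.1} * Real.log N ≤
      -(n * (Real.log (2 * Real.pi) + 1)) -
        ∫ ω, L ω.1 ω.2.1 (x ω.1 ω.2.1 + ω.2.2) ∂(stdLaw n N₁ N₂) + 1 := by
  have hN₁ : (N₁ : ℝ≥0∞) ≠ 0 := by simp [NeZero.ne]
  have hN₂ : (N₂ : ℝ≥0∞) ≠ 0 := by simp [NeZero.ne]
  have hNN : (N₁ : ℝ≥0∞)⁻¹ * (N₂ : ℝ≥0∞)⁻¹ * (N₁ * N₂) = 1 := by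
    rw [mul_mul_mul_comm, ENNReal.inv_mul_cancel hN₁ (by simp),
      ENNReal.inv_mul_cancel hN₂ (by simp), one_mul]
  have hy : Measurable fun ω : Sample n N₁ N₂ => x ω.1 ω.2.1 + ω.2.2 :=
    measurable_sample fun m => by
      exact ((hx m).comp measurable_fst).add measurable_snd
  have hLm : Measurable fun ω : Sample n N₁ N₂ => L ω.1 ω.2.1 (x ω.1 ω.2.1 + ω.2.2) :=
    measurable_sample fun m =>
      (hL m).comp (measurable_fst.prodMk (hy.comp (measurable_prodMk_left (x := m))))
  have hA : MeasurableSet {ω : Sample n N₁ N₂ | dec (x ω.1 ω.2.1 + ω.2.2) = ω.1} :=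
    measurableSet_eq_fun (hdec.comp hy) measurable_fst
  have hT : ∀ i, MemLp (fun ω : Sample n N₁ N₂ => ω.2.1 i - (0 : Fin n → ℝ) i) 2
      (stdLaw n N₁ N₂) := fun i => by
    simpa using memLp_two_of_gaussian (measurePreserving_fst_apply i)
  have hZ : ∀ i, MemLp (fun ω : Sample n N₁ N₂ => ω.2.2 i - (0 : Fin n → ℝ) i) 2
      (stdLaw n N₁ N₂) := fun i => by
    simpa using memLp_two_of_gaussian (measurePreserving_snd_apply i)
  have hiT := integrable_logGauss 1 hT
  have hiZ := integrable_logGauss 1 hZ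
  obtain ⟨ℓ, hℓ⟩ : ∃ ℓ : Sample n N₁ N₂ → ℝ, ℓ = fun ω => L ω.1 ω.2.1 (x ω.1 ω.2.1 + ω.2.2) -
    logGauss 1 0 ω.2.1 - logGauss 1 0 ω.2.2 := ⟨_, rfl⟩
  have hℓm : Measurable ℓ := hℓ ▸ (hLm.sub (by fun_prop)).sub (by fun_prop)
  have hℓi : Integrable ℓ (stdLaw n N₁ N₂) := hℓ ▸ (hint.sub hiT).sub hiZ
  -- Given m, the true density of (T, Y) is the density of T times that of Z at Y − x(T), so
  -- weighting by exp ℓ replaces the true law by the reference.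
  have hchange : ∀ m, ∀ F : (Fin n → ℝ) → ℝ≥0∞, Measurable F →
      ∫⁻ t, ∫⁻ z, ENNReal.ofReal (Real.exp (ℓ (m, (t, z)))) * F (x m t + z)
        ∂(stdGauss n) ∂(stdGauss n) = ∫⁻ t, ∫⁻ y, ENNReal.ofReal (Real.exp (L m t y)) * F y :=
    fun m F hF => by rw [hℓ]; exact lintegral_stdGauss_change (hx m) (hL m) hF
  have hmain := measureReal_mul_log_le (μ := stdLaw n N₁ N₂) hℓm hℓi hA hN ?_ ?_
  -- The constant n(log 2π + 1) is the differential entropy of the pair (Tⁿ, Zⁿ).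
  · have hI : ∫ ω, ℓ ω ∂(stdLaw n N₁ N₂) =
        ∫ ω, L ω.1 ω.2.1 (x ω.1 ω.2.1 + ω.2.2) ∂(stdLaw n N₁ N₂) +
          n * (Real.log (2 * Real.pi) + 1) := by
      have e1 := integral_logGauss 1 hT
      have e2 := integral_logGauss 1 hZ
      simp only [Pi.zero_apply, sub_zero,
        integral_sq_of_gaussian (measurePreserving_fst_apply _),
        integral_sq_of_gaussian (measurePreserving_snd_apply _)] at e1 e2
      have e3 := integral_sub' (hint.sub hiT) hiZ
      rw [integral_sub' hint hiT, e1, e2] at e3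
      rw [hℓ]
      refine e3.trans ?_
      simp
      ring
    rw [hI] at hmain
    linarith
  · rw [lintegral_stdLaw (by fun_prop)]
    calc _ ≤ (N₁ : ℝ≥0∞)⁻¹ * (N₂ : ℝ≥0∞)⁻¹ * ∑ _m : Fin N₁ × Fin N₂, 1 := by
          gcongr with m
          have := hchange m 1 measurable_const
          simp only [Pi.one_apply, mul_one] at this
          exact this.trans_le (h1 m)
      _ = 1 := by simpa using hNN
  · rw [← lintegral_indicator hA, lintegral_stdLaw ((by fun_prop : Measurable
      fun ω => ENNReal.ofReal (Real.exp (ℓ ω))).indicator hA)]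
    calc _ = (N₁ : ℝ≥0∞)⁻¹ * (N₂ : ℝ≥0∞)⁻¹ * (ENNReal.ofReal N * ∑ m, ∫⁻ t, ∫⁻ y,
          ENNReal.ofReal (Real.exp (L m t y)) * (dec ⁻¹' {m}).indicator 1 y) := by
          rw [mul_left_comm]
          congr 2
          refine Finset.sum_congr rfl fun m _ => ?_
          rw [← hchange m _ (measurable_one.indicator (hdec (measurableSet_singleton m)))]
          refine lintegral_congr fun t => lintegral_congr fun z => ?_
          by_cases h : dec (x m t + z) = m <;> simp [Set.indicator, h]
      _ ≤ 1 := (mul_le_mul_right h2 _).trans hNN.le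

end Standard

lemma integral_linear_combination {Ω : Type*} [MeasurableSpace Ω] {μ : Measure Ω} {f g h : Ω → ℝ}
    (hf : Integrable f μ) (hg : Integrable g μ) (hh : Integrable h μ) (c d : ℝ) :
    ∫ ω, (f ω + c * g ω + d * h ω) ∂μ = ∫ ω, f ω ∂μ + c * ∫ ω, g ω ∂μ + d * ∫ ω, h ω ∂μ := by
  have hfg : Integrable (fun ω => f ω + c * g ω) μ := hf.add (hg.const_mul c)
  rw [integral_add hfg (hh.const_mul d), integral_add hf (hg.const_mul c), integral_const_mul,
    integral_const_mul]

/-! ### Cross terms, second moments and decoding mass under reference laws. -/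

section References

variable {n N₁ N₂ : ℕ}

lemma integral_mul_noise {g : Fin N₁ × Fin N₂ → (Fin n → ℝ) → ℝ} {i : Fin n}
    (h : Integrable (fun ω => g ω.1 ω.2.1 * ω.2.2 i) (stdLaw n N₁ N₂)) :
    ∫ ω, g ω.1 ω.2.1 * ω.2.2 i ∂(stdLaw n N₁ N₂) = 0 := by
  rw [stdLaw] at h ⊢
  rw [integral_prod _ h]
  have hz : ∫ z, z i ∂(stdGauss n) = 0 :=
    integral_of_gaussian (v := 1) (measurePreserving_eval (fun _ : Fin n => gaussianReal 0 1) i)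
  simp_rw [integral_prod_mul (μ := stdGauss n) (ν := stdGauss n) (g _)
    (fun z : Fin n → ℝ => z i), hz]
  simp

lemma integral_mul_centered {g : Fin N₁ → (Fin n → ℝ) → ℝ} {f : Fin N₂ → ℝ}
    (hf : ∫ m, f m ∂(uniformOn (Set.univ : Set (Fin N₂))) = 0)
    (h : Integrable (fun ω => g ω.1.1 ω.2.1 * f ω.1.2) (stdLaw n N₁ N₂)) :
    ∫ ω, g ω.1.1 ω.2.1 * f ω.1.2 ∂(stdLaw n N₁ N₂) = 0 := by
  rw [stdLaw] at h ⊢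
  rw [integral_prod _ h]
  simp_rw [integral_mul_const]
  rw [integral_prod_mul (fun m₁ => ∫ p, g m₁ p.1 ∂((stdGauss n).prod (stdGauss n))) f, hf,
    mul_zero]

variable {dec : (Fin n → ℝ) → Fin N₁ × Fin N₂}

/-- Only an inequality: the sum vanishes when the decoder outputs a second message other than m₂. -/
lemma sum_indicator_fst_le (y : Fin n → ℝ) (m₂ : Fin N₂) :
    ∑ m₁, (dec ⁻¹' {(m₁, m₂)}).indicator (1 : (Fin n → ℝ) → ℝ≥0∞) y ≤ 1 := by
  calc _ ≤ ∑ m₁, if (dec y).1 = m₁ then (1 : ℝ≥0∞) else 0 := by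
        refine Finset.sum_le_sum fun m₁ _ => ?_
        by_cases h : dec y = (m₁, m₂) <;> simp [Set.indicator, h]
    _ = 1 := by simp

lemma sum_indicator_snd_le (y : Fin n → ℝ) (m₁ : Fin N₁) :
    ∑ m₂, (dec ⁻¹' {(m₁, m₂)}).indicator (1 : (Fin n → ℝ) → ℝ≥0∞) y ≤ 1 := by
  calc _ ≤ ∑ m₂, if (dec y).2 = m₂ then (1 : ℝ≥0∞) else 0 := by
        refine Finset.sum_le_sum fun m₂ _ => ?_
        by_cases h : dec y = (m₁, m₂) <;> simp [Set.indicator, h]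
    _ = 1 := by simp

lemma sum_indicator_eq_one (y : Fin n → ℝ) :
    ∑ m, (dec ⁻¹' {m}).indicator (1 : (Fin n → ℝ) → ℝ≥0∞) y = 1 := by
  calc _ = ∑ m, if dec y = m then (1 : ℝ≥0∞) else 0 := by
        refine Finset.sum_congr rfl fun m _ => ?_
        by_cases h : dec y = m <;> simp [Set.indicator, h]
    _ = 1 := by simp

lemma integral_message [NeZero N₁] (f : Fin N₂ → ℝ) :
    ∫ ω, f ω.1.2 ∂(stdLaw n N₁ N₂) = ∫ m, f m ∂(uniformOn (Set.univ : Set (Fin N₂))) := by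
  have h : MeasurePreserving (fun ω : Sample n N₁ N₂ => ω.1.2) (stdLaw n N₁ N₂)
      (uniformOn Set.univ) := measurePreserving_snd.comp measurePreserving_fst
  rw [← h.map_eq, integral_map h.measurable.aemeasurable
    (measurable_of_finite f).aestronglyMeasurable]

variable {x₁ : Fin N₁ → (Fin n → ℝ) → Fin n → ℝ}

lemma measurable_encoded (hx₁ : ∀ m, Measurable (x₁ m)) (x₂ : Fin N₂ → Fin n → ℝ) (k : ℝ)
    (m : Fin N₁ × Fin N₂) : Measurable fun t => x₁ m.1 t + x₂ m.2 + k • t :=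
  ((hx₁ m.1).add_const _).add (measurable_id.const_smul k)

variable [NeZero N₁] [NeZero N₂]

lemma integral_sq_add_noise {g : Fin N₁ × Fin N₂ → (Fin n → ℝ) → ℝ} (i : Fin n) (b : ℝ)
    (h : MemLp (fun ω => g ω.1 ω.2.1) 2 (stdLaw n N₁ N₂)) :
    ∫ ω, (g ω.1 ω.2.1 + b * ω.2.2 i) ^ 2 ∂(stdLaw n N₁ N₂) =
      ∫ ω, g ω.1 ω.2.1 ^ 2 ∂(stdLaw n N₁ N₂) + b ^ 2 := by
  have hZ : MemLp (fun ω : Sample n N₁ N₂ => ω.2.2 i) 2 (stdLaw n N₁ N₂) :=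
    memLp_two_of_gaussian (measurePreserving_snd_apply i)
  have hi : Integrable (fun ω => g ω.1 ω.2.1 * ω.2.2 i) (stdLaw n N₁ N₂) := h.integrable_mul hZ
  have hZ2 := integral_sq_of_gaussian (measurePreserving_snd_apply (N₁ := N₁) (N₂ := N₂) i)
  calc _ = ∫ ω, (g ω.1 ω.2.1 ^ 2 + 2 * b * (g ω.1 ω.2.1 * ω.2.2 i)) + b ^ 2 * ω.2.2 i ^ 2
        ∂(stdLaw n N₁ N₂) := by
        congr 1 with ω
        ring
    _ = _ := by
        rw [integral_linear_combination h.integrable_sq hi hZ.integrable_sq, hZ2,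
          integral_mul_noise hi]
        simp

lemma memLp_message (f : Fin N₂ → ℝ) :
    MemLp (fun ω : Sample n N₁ N₂ => f ω.1.2) 2 (stdLaw n N₁ N₂) :=
  MemLp.of_bound (C := ∑ m, ‖f m‖)
    ((measurable_of_finite f).comp (by fun_prop)).aestronglyMeasurable
    (ae_of_all _ fun ω => Finset.single_le_sum (f := fun m => ‖f m‖)
      (fun m _ => norm_nonneg _) (Finset.mem_univ ω.1.2))

/-- The centred function of M₂ is independent of (M₁, T), so the cross term vanishes, and a variance
is at most a second moment. Centring is what removes the product of the means of X₁ + S and X₂. -/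
lemma integral_sq_add_centered_le {g : Fin N₁ → (Fin n → ℝ) → ℝ} (f : Fin N₂ → ℝ)
    (h : MemLp (fun ω => g ω.1.1 ω.2.1) 2 (stdLaw n N₁ N₂)) :
    ∫ ω, (g ω.1.1 ω.2.1 + (f ω.1.2 - ∫ m, f m ∂(uniformOn (Set.univ : Set (Fin N₂))))) ^ 2
        ∂(stdLaw n N₁ N₂) ≤
      ∫ ω, g ω.1.1 ω.2.1 ^ 2 ∂(stdLaw n N₁ N₂) + ∫ ω, f ω.1.2 ^ 2 ∂(stdLaw n N₁ N₂) := by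
  set e := ∫ m, f m ∂(uniformOn (Set.univ : Set (Fin N₂))) with he
  have hf := memLp_message (n := n) (N₁ := N₁) f
  have hc := memLp_message (n := n) (N₁ := N₁) (fun m => f m - e)
  have hi : Integrable (fun ω => g ω.1.1 ω.2.1 * (f ω.1.2 - e)) (stdLaw n N₁ N₂) :=
    h.integrable_mul hc
  have h0 : ∫ ω, g ω.1.1 ω.2.1 * (f ω.1.2 - e) ∂(stdLaw n N₁ N₂) = 0 := by
    refine integral_mul_centered (f := fun m => f m - e) ?_ hi
    rw [integral_sub .of_finite (integrable_const _), ← he]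
    simp
  have hf1 : Integrable (fun ω => f ω.1.2) (stdLaw n N₁ N₂) := hf.integrable (by norm_num)
  have hvar : ∫ ω, (f ω.1.2 - e) ^ 2 ∂(stdLaw n N₁ N₂) ≤ ∫ ω, f ω.1.2 ^ 2 ∂(stdLaw n N₁ N₂) := by
    calc _ = ∫ ω, f ω.1.2 ^ 2 + (-2 * e) * f ω.1.2 + e ^ 2 * 1 ∂(stdLaw n N₁ N₂) := by
          congr 1 with ω
          ring
      _ = ∫ ω, f ω.1.2 ^ 2 ∂(stdLaw n N₁ N₂) - 2 * e * e + e ^ 2 := by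
          rw [integral_linear_combination hf.integrable_sq hf1 (integrable_const _),
            integral_message, ← he]
          simp
          ring
      _ ≤ _ := by nlinarith [sq_nonneg e]
  calc _ = ∫ ω, (g ω.1.1 ω.2.1 ^ 2 + 2 * (g ω.1.1 ω.2.1 * (f ω.1.2 - e))) + 1 * (f ω.1.2 - e) ^ 2
        ∂(stdLaw n N₁ N₂) := by
        congr 1 with ω
        ring
    _ = ∫ ω, g ω.1.1 ω.2.1 ^ 2 ∂(stdLaw n N₁ N₂) +
        ∫ ω, (f ω.1.2 - e) ^ 2 ∂(stdLaw n N₁ N₂) := by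
        rw [integral_linear_combination h.integrable_sq hi hc.integrable_sq, h0]
        simp
    _ ≤ _ := by gcongr

lemma lintegral_exp_logGauss_add {D : ℝ} (hD : 0 < D) (f : (Fin n → ℝ) → Fin n → ℝ) :
    ∫⁻ t, ∫⁻ y, ENNReal.ofReal (Real.exp (logGauss 1 0 t + logGauss D (f t) y)) = 1 := by
  simp_rw [Real.exp_add, ENNReal.ofReal_mul (Real.exp_pos _).le]
  have : ∀ t : Fin n → ℝ, ∫⁻ y, ENNReal.ofReal (Real.exp (logGauss 1 0 t)) *
      ENNReal.ofReal (Real.exp (logGauss D (f t) y)) =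
      ENNReal.ofReal (Real.exp (logGauss 1 0 t)) := fun t => by
    rw [lintegral_const_mul _ (by fun_prop), lintegral_exp_logGauss hD, mul_one]
  simp_rw [this]
  exact lintegral_exp_logGauss one_pos 0

/-- Mass of the correct decisions under densities `exp L` which do not depend on the message. -/
lemma sum_lintegral_mul_indicator_le {M : Type*} [Fintype M] {B : M → Set (Fin n → ℝ)}
    (hB : ∀ m, MeasurableSet (B m))
    (hsum : ∀ y, ∑ m, (B m).indicator (1 : (Fin n → ℝ) → ℝ≥0∞) y ≤ 1)
    {L : (Fin n → ℝ) → (Fin n → ℝ) → ℝ} (hL : Measurable (Function.uncurry L))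
    (h1 : ∫⁻ t, ∫⁻ y, ENNReal.ofReal (Real.exp (L t y)) ≤ 1) :
    ∑ m, ∫⁻ t, ∫⁻ y, ENNReal.ofReal (Real.exp (L t y)) * (B m).indicator 1 y ≤ 1 := by
  have hm : ∀ m, Measurable fun p : (Fin n → ℝ) × (Fin n → ℝ) =>
      ENNReal.ofReal (Real.exp (L p.1 p.2)) * (B m).indicator 1 p.2 := fun m => by
    have h1 : Measurable fun p : (Fin n → ℝ) × (Fin n → ℝ) => L p.1 p.2 := hL
    have h2 : Measurable ((B m).indicator (1 : (Fin n → ℝ) → ℝ≥0∞)) :=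
      measurable_one.indicator (hB m)
    fun_prop
  rw [← lintegral_finsetSum _ fun m _ => (hm m).lintegral_prod_right']
  refine (lintegral_mono fun t => ?_).trans h1
  have hmt : ∀ m, Measurable fun y => ENNReal.ofReal (Real.exp (L t y)) *
      (B m).indicator (1 : (Fin n → ℝ) → ℝ≥0∞) y := fun m => (hm m).comp measurable_prodMk_left
  simp only
  rw [← lintegral_finsetSum _ fun m _ => hmt m]
  refine lintegral_mono fun y => ?_
  rw [← Finset.mul_sum]
  exact mul_le_of_le_one_right' (hsum y)

/-! ### The three converse bounds with free parameters. -/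

/-- Probability that both messages are decoded correctly. -/
def successProb (x₁ : Fin N₁ → (Fin n → ℝ) → Fin n → ℝ) (x₂ : Fin N₂ → Fin n → ℝ) (k : ℝ)
    (dec : (Fin n → ℝ) → Fin N₁ × Fin N₂) : ℝ :=
  (stdLaw n N₁ N₂).real
    {ω | dec (x₁ ω.1.1 ω.2.1 + x₂ ω.1.2 + k • ω.2.1 + ω.2.2) = ω.1}

lemma memLp_fst_apply (i : Fin n) :
    MemLp (fun ω : Sample n N₁ N₂ => ω.2.1 i) 2 (stdLaw n N₁ N₂) :=
  memLp_two_of_gaussian (measurePreserving_fst_apply i)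

lemma memLp_snd_apply (i : Fin n) :
    MemLp (fun ω : Sample n N₁ N₂ => ω.2.2 i) 2 (stdLaw n N₁ N₂) :=
  memLp_two_of_gaussian (measurePreserving_snd_apply i)

lemma integrable_logGauss_fst :
    Integrable (fun ω : Sample n N₁ N₂ => logGauss 1 0 ω.2.1) (stdLaw n N₁ N₂) :=
  integrable_logGauss 1 fun i => by simpa using memLp_fst_apply i

lemma integral_logGauss_fst :
    ∫ ω : Sample n N₁ N₂, logGauss 1 0 ω.2.1 ∂(stdLaw n N₁ N₂) =
      -(n * (Real.log (2 * Real.pi) / 2)) - n / 2 := by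
  have h := integral_logGauss (μ := stdLaw n N₁ N₂) 1 (m := fun _ => 0) (u := fun ω => ω.2.1)
    fun i => by simpa using memLp_fst_apply i
  simp only [Pi.zero_apply, sub_zero,
    integral_sq_of_gaussian (measurePreserving_fst_apply _)] at h
  rw [h]
  simp

lemma log_two_pi_mul {D : ℝ} (hD : 0 < D) :
    Real.log (2 * Real.pi * D) = Real.log (2 * Real.pi) + Real.log D :=
  Real.log_mul (by positivity) hD.ne'

lemma one_le_cast (N : ℕ) [NeZero N] : (1 : ℝ) ≤ N := by
  exact_mod_cast Nat.one_le_iff_ne_zero.2 (NeZero.ne N)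

/-- The reference for Y given T is N((a + k)T + x₂(m₂), D). It does not involve m₁, so for each m₂
the correct decisions have total mass at most 1 over all m₁. The residual of Y is (X₁ − aT) + Z. -/
lemma successProb_mul_log_fst_le (hx₁ : ∀ m, Measurable (x₁ m)) (x₂ : Fin N₂ → Fin n → ℝ)
    (k : ℝ) (hdec : Measurable dec)
    (hX : ∀ i, MemLp (fun ω => x₁ ω.1.1 ω.2.1 i) 2 (stdLaw n N₁ N₂)) (a : ℝ) {D : ℝ}
    (hD : 0 < D) :
    successProb x₁ x₂ k dec * Real.log N₁ ≤ n / 2 * Real.log D - n / 2 +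
      (∑ i, ∫ ω, (x₁ ω.1.1 ω.2.1 i - a * ω.2.1 i) ^ 2 ∂(stdLaw n N₁ N₂) + n) / (2 * D) + 1 := by
  have hd : ∀ (ω : Sample n N₁ N₂) i, (x₁ ω.1.1 ω.2.1 + x₂ ω.1.2 + k • ω.2.1 + ω.2.2) i -
      ((a + k) • ω.2.1 + x₂ ω.1.2) i = (x₁ ω.1.1 ω.2.1 i - a * ω.2.1 i) + 1 * ω.2.2 i := by
    intro ω i
    simp only [Pi.add_apply, Pi.smul_apply, smul_eq_mul]
    ring
  have hU : ∀ i, MemLp (fun ω => x₁ ω.1.1 ω.2.1 i - a * ω.2.1 i) 2 (stdLaw n N₁ N₂) :=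
    fun i => (hX i).sub ((memLp_fst_apply i).const_mul a)
  have hM : ∀ i, MemLp (fun ω : Sample n N₁ N₂ =>
      (x₁ ω.1.1 ω.2.1 + x₂ ω.1.2 + k • ω.2.1 + ω.2.2) i - ((a + k) • ω.2.1 + x₂ ω.1.2) i) 2
      (stdLaw n N₁ N₂) := fun i => by
    simp_rw [hd]
    exact (hU i).add ((memLp_snd_apply i).const_mul 1)
  have hL : ∀ m : Fin N₁ × Fin N₂, Measurable (Function.uncurry fun t y : Fin n → ℝ =>
      logGauss 1 0 t + logGauss D ((a + k) • t + x₂ m.2) y) := fun m => by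
    unfold Function.uncurry
    fun_prop
  have hi := integrable_logGauss D hM
  have h := success_mul_log_le (measurable_encoded hx₁ x₂ k) hdec
    (L := fun m t y => logGauss 1 0 t + logGauss D ((a + k) • t + x₂ m.2) y) hL
    (integrable_logGauss_fst.add hi) (one_le_cast N₁)
    (fun m => (lintegral_exp_logGauss_add hD _).le) ?_
  · rw [integral_add integrable_logGauss_fst hi, integral_logGauss_fst, integral_logGauss D hM]
      at h
    simp_rw [hd] at h
    rw [Finset.sum_congr rfl fun i _ => integral_sq_add_noise
      (g := fun m t => x₁ m.1 t i - a * t i) i 1 (hU i)] at h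
    refine h.trans_eq ?_
    rw [log_two_pi_mul hD]
    simp [Finset.sum_add_distrib]
    ring
  · rw [Fintype.sum_prod_type_right, ENNReal.ofReal_natCast]
    gcongr
    calc _ ≤ ∑ _m₂ : Fin N₂, (1 : ℝ≥0∞) := Finset.sum_le_sum fun m₂ _ =>
          sum_lintegral_mul_indicator_le (fun m₁ => hdec (measurableSet_singleton _))
            (fun y => sum_indicator_fst_le y m₂) (hL (0, m₂))
            (lintegral_exp_logGauss_add hD _).le
      _ = N₂ := by simp

/-- The reference for Y given T is N(x₁(m₁, T) + kT, D), independent of m₂; the residual of Y is X₂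
+ Z. -/
lemma successProb_mul_log_snd_le (hx₁ : ∀ m, Measurable (x₁ m)) (x₂ : Fin N₂ → Fin n → ℝ)
    (k : ℝ) (hdec : Measurable dec) {D : ℝ} (hD : 0 < D) :
    successProb x₁ x₂ k dec * Real.log N₂ ≤ n / 2 * Real.log D - n / 2 +
      (∑ i, ∫ ω, x₂ ω.1.2 i ^ 2 ∂(stdLaw n N₁ N₂) + n) / (2 * D) + 1 := by
  have hd : ∀ (ω : Sample n N₁ N₂) i, (x₁ ω.1.1 ω.2.1 + x₂ ω.1.2 + k • ω.2.1 + ω.2.2) i -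
      (x₁ ω.1.1 ω.2.1 + k • ω.2.1) i = x₂ ω.1.2 i + 1 * ω.2.2 i := by
    intro ω i
    simp only [Pi.add_apply, Pi.smul_apply, smul_eq_mul]
    ring
  have hU : ∀ i, MemLp (fun ω : Sample n N₁ N₂ => x₂ ω.1.2 i) 2 (stdLaw n N₁ N₂) :=
    fun i => memLp_message fun m => x₂ m i
  have hM : ∀ i, MemLp (fun ω : Sample n N₁ N₂ =>
      (x₁ ω.1.1 ω.2.1 + x₂ ω.1.2 + k • ω.2.1 + ω.2.2) i - (x₁ ω.1.1 ω.2.1 + k • ω.2.1) i) 2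
      (stdLaw n N₁ N₂) := fun i => by
    simp_rw [hd]
    exact (hU i).add ((memLp_snd_apply i).const_mul 1)
  have hL : ∀ m : Fin N₁ × Fin N₂, Measurable (Function.uncurry fun t y : Fin n → ℝ =>
      logGauss 1 0 t + logGauss D (x₁ m.1 t + k • t) y) := fun m => by
    have := hx₁ m.1
    unfold Function.uncurry
    fun_prop
  have hi := integrable_logGauss D hM
  have h := success_mul_log_le (measurable_encoded hx₁ x₂ k) hdec
    (L := fun m t y => logGauss 1 0 t + logGauss D (x₁ m.1 t + k • t) y) hL
    (integrable_logGauss_fst.add hi) (one_le_cast N₂)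
    (fun m => (lintegral_exp_logGauss_add hD _).le) ?_
  · rw [integral_add integrable_logGauss_fst hi, integral_logGauss_fst, integral_logGauss D hM]
      at h
    simp_rw [hd] at h
    rw [Finset.sum_congr rfl fun i _ => integral_sq_add_noise
      (g := fun m _ => x₂ m.2 i) i 1 (hU i)] at h
    refine h.trans_eq ?_
    rw [log_two_pi_mul hD]
    simp [Finset.sum_add_distrib]
    ring
  · rw [Fintype.sum_prod_type, ENNReal.ofReal_natCast, mul_comm]
    gcongr
    calc _ ≤ ∑ _m₁ : Fin N₁, (1 : ℝ≥0∞) := Finset.sum_le_sum fun m₁ _ =>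
          sum_lintegral_mul_indicator_le (fun m₂ => hdec (measurableSet_singleton _))
            (fun y => sum_indicator_snd_le y m₁) (hL (m₁, 0))
            (lintegral_exp_logGauss_add hD _).le
      _ = N₁ := by simp

/-- The reference takes Y ∼ N(e, w) and then T ∼ N(b(Y − x₂(m₂)), q). The message enters only
through T, which the decoder does not see, so correct decisions have total mass 1 over all N₁N₂
pairs. -/
lemma successProb_mul_log_le (hx₁ : ∀ m, Measurable (x₁ m)) (x₂ : Fin N₂ → Fin n → ℝ)
    (k : ℝ) (hdec : Measurable dec)
    (hX : ∀ i, MemLp (fun ω => x₁ ω.1.1 ω.2.1 i) 2 (stdLaw n N₁ N₂)) (b : ℝ) {w q : ℝ}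
    (hw : 0 < w) (hq : 0 < q) :
    successProb x₁ x₂ k dec * Real.log (N₁ * N₂) ≤ n / 2 * Real.log w + n / 2 * Real.log q - n +
      (∑ i, ∫ ω, (x₁ ω.1.1 ω.2.1 i + k * ω.2.1 i) ^ 2 ∂(stdLaw n N₁ N₂) +
        ∑ i, ∫ ω, x₂ ω.1.2 i ^ 2 ∂(stdLaw n N₁ N₂) + n) / (2 * w) +
      (∑ i, ∫ ω, (ω.2.1 i - b * (x₁ ω.1.1 ω.2.1 i + k * ω.2.1 i)) ^ 2 ∂(stdLaw n N₁ N₂) +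
        n * b ^ 2) / (2 * q) + 1 := by
  set e : Fin n → ℝ := fun i => ∫ m, x₂ m i ∂(uniformOn (Set.univ : Set (Fin N₂))) with he
  have hd₁ : ∀ (ω : Sample n N₁ N₂) i, (x₁ ω.1.1 ω.2.1 + x₂ ω.1.2 + k • ω.2.1 + ω.2.2) i - e i =
      ((x₁ ω.1.1 ω.2.1 i + k * ω.2.1 i) + (x₂ ω.1.2 i - e i)) + 1 * ω.2.2 i := by
    intro ω i
    simp only [Pi.add_apply, Pi.smul_apply, smul_eq_mul]
    ring
  have hd₂ : ∀ (ω : Sample n N₁ N₂) i, ω.2.1 i -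
      (b • (x₁ ω.1.1 ω.2.1 + x₂ ω.1.2 + k • ω.2.1 + ω.2.2 - x₂ ω.1.2)) i =
      (ω.2.1 i - b * (x₁ ω.1.1 ω.2.1 i + k * ω.2.1 i)) + -b * ω.2.2 i := by
    intro ω i
    simp only [Pi.add_apply, Pi.sub_apply, Pi.smul_apply, smul_eq_mul]
    ring
  have hV : ∀ i, MemLp (fun ω => x₁ ω.1.1 ω.2.1 i + k * ω.2.1 i) 2 (stdLaw n N₁ N₂) :=
    fun i => (hX i).add ((memLp_fst_apply i).const_mul k)
  have hU₁ : ∀ i, MemLp (fun ω : Sample n N₁ N₂ =>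
      (x₁ ω.1.1 ω.2.1 i + k * ω.2.1 i) + (x₂ ω.1.2 i - e i)) 2 (stdLaw n N₁ N₂) :=
    fun i => (hV i).add (memLp_message fun m => x₂ m i - e i)
  have hU₂ : ∀ i, MemLp (fun ω => ω.2.1 i - b * (x₁ ω.1.1 ω.2.1 i + k * ω.2.1 i)) 2
      (stdLaw n N₁ N₂) := fun i => (memLp_fst_apply i).sub ((hV i).const_mul b)
  have hM₁ : ∀ i, MemLp (fun ω : Sample n N₁ N₂ =>
      (x₁ ω.1.1 ω.2.1 + x₂ ω.1.2 + k • ω.2.1 + ω.2.2) i - e i) 2 (stdLaw n N₁ N₂) := fun i => by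
    simp_rw [hd₁]
    exact (hU₁ i).add ((memLp_snd_apply i).const_mul 1)
  have hM₂ : ∀ i, MemLp (fun ω : Sample n N₁ N₂ => ω.2.1 i -
      (b • (x₁ ω.1.1 ω.2.1 + x₂ ω.1.2 + k • ω.2.1 + ω.2.2 - x₂ ω.1.2)) i) 2
      (stdLaw n N₁ N₂) := fun i => by
    simp_rw [hd₂]
    exact (hU₂ i).add ((memLp_snd_apply i).const_mul (-b))
  have hL : ∀ m : Fin N₁ × Fin N₂, Measurable (Function.uncurry fun t y : Fin n → ℝ =>
      logGauss w e y + logGauss q (b • (y - x₂ m.2)) t) := fun m => by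
    unfold Function.uncurry
    fun_prop
  have hi₁ := integrable_logGauss w hM₁
  have hi₂ := integrable_logGauss q hM₂
  -- Integrating over t first: the Gaussian factor in t has mass one for every y, whatever its mean,
  -- so the message disappears from the marginal of Y.
  have hmass : ∀ (m₂ : Fin N₂) (F : (Fin n → ℝ) → ℝ≥0∞), Measurable F →
      ∫⁻ t, ∫⁻ y, ENNReal.ofReal (Real.exp (logGauss w e y + logGauss q (b • (y - x₂ m₂)) t)) *
        F y = ∫⁻ y, ENNReal.ofReal (Real.exp (logGauss w e y)) * F y := by
    intro m₂ F hF
    rw [lintegral_lintegral_swap]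
    · refine lintegral_congr fun y => ?_
      simp_rw [Real.exp_add, ENNReal.ofReal_mul (Real.exp_pos _).le, mul_right_comm _ _ (F y)]
      rw [lintegral_const_mul _ (by fun_prop), lintegral_exp_logGauss hq, mul_one]
    · unfold Function.uncurry
      fun_prop
  have h := success_mul_log_le (measurable_encoded hx₁ x₂ k) hdec
    (L := fun m t y => logGauss w e y + logGauss q (b • (y - x₂ m.2)) t) hL
    (hi₁.add hi₂) (one_le_mul_of_one_le_of_one_le (one_le_cast N₁) (one_le_cast N₂)) ?_ ?_
  · rw [integral_add hi₁ hi₂, integral_logGauss w hM₁, integral_logGauss q hM₂] at h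
    simp_rw [hd₁, hd₂] at h
    rw [Finset.sum_congr rfl fun i _ => integral_sq_add_noise
        (g := fun m t => (x₁ m.1 t i + k * t i) + (x₂ m.2 i - e i)) i 1 (hU₁ i),
      Finset.sum_congr rfl fun i _ => integral_sq_add_noise
        (g := fun m t => t i - b * (x₁ m.1 t i + k * t i)) i (-b) (hU₂ i)] at h
    have hc : ∑ i, (∫ ω, ((x₁ ω.1.1 ω.2.1 i + k * ω.2.1 i) + (x₂ ω.1.2 i - e i)) ^ 2
        ∂(stdLaw n N₁ N₂) + 1 ^ 2) ≤
        ∑ i, ∫ ω, (x₁ ω.1.1 ω.2.1 i + k * ω.2.1 i) ^ 2 ∂(stdLaw n N₁ N₂) +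
          ∑ i, ∫ ω, x₂ ω.1.2 i ^ 2 ∂(stdLaw n N₁ N₂) + n := by
      calc _ ≤ ∑ i, (∫ ω, (x₁ ω.1.1 ω.2.1 i + k * ω.2.1 i) ^ 2 ∂(stdLaw n N₁ N₂) +
            ∫ ω, x₂ ω.1.2 i ^ 2 ∂(stdLaw n N₁ N₂) + 1) := by
            refine Finset.sum_le_sum fun i _ => ?_
            have := integral_sq_add_centered_le (g := fun m t => x₁ m t i + k * t i)
              (fun m => x₂ m i) (hV i)
            simpa using this
        _ = _ := by simp [Finset.sum_add_distrib]
    have hc' := div_le_div_of_nonneg_right hc (by positivity : 0 ≤ 2 * w)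
    rw [Finset.sum_add_distrib (f := fun i => ∫ ω : Sample n N₁ N₂,
      (ω.2.1 i - b * (x₁ ω.1.1 ω.2.1 i + k * ω.2.1 i)) ^ 2 ∂(stdLaw n N₁ N₂))] at h
    simp only [Finset.sum_const, Finset.card_univ, Fintype.card_fin, nsmul_eq_mul, neg_sq] at h
    rw [log_two_pi_mul hw, log_two_pi_mul hq] at h
    refine h.trans ?_
    linarith
  · intro m
    have := hmass m.2 1 measurable_const
    simp only [Pi.one_apply, mul_one] at this
    exact this.trans_le (lintegral_exp_logGauss hw e).le
  · rw [ENNReal.ofReal_mul (by positivity), ENNReal.ofReal_natCast, ENNReal.ofReal_natCast]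
    refine mul_le_of_le_one_right' ?_
    have hind : ∀ m, Measurable ((dec ⁻¹' {m}).indicator (1 : (Fin n → ℝ) → ℝ≥0∞)) := fun m =>
      measurable_one.indicator (hdec (measurableSet_singleton m))
    have hmul : ∀ m, Measurable fun y => ENNReal.ofReal (Real.exp (logGauss w e y)) *
        (dec ⁻¹' {m}).indicator (1 : (Fin n → ℝ) → ℝ≥0∞) y := fun m => by
      have := hind m
      fun_prop
    rw [Finset.sum_congr rfl fun m _ => hmass m.2 _ (hind m),
      ← lintegral_finsetSum _ fun m _ => hmul m]
    simp_rw [← Finset.mul_sum, sum_indicator_eq_one, mul_one]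
    exact (lintegral_exp_logGauss hw e).le

end References

/-! ### Finite-blocklength converse with one correlation parameter. -/

section Converse

variable {n N₁ N₂ : ℕ}

/-- Writing S = √Q·T keeps densities available even when Q = 0, where S itself has none. -/
lemma blockLaw_eq_map (Q : ℝ≥0) : blockLaw n N₁ N₂ Q =
    (stdLaw n N₁ N₂).map (Prod.map id (Prod.map (fun t => √(Q : ℝ) • t) id)) := by
  have h : (Measure.pi fun _ : Fin n => gaussianReal 0 Q) =
      (stdGauss n).map (fun t => √(Q : ℝ) • t) := by
    have hg : (gaussianReal 0 1).map (fun x => √(Q : ℝ) * x) = gaussianReal 0 Q := by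
      rw [gaussianReal_map_const_mul]
      congr 1
      · simp
      · ext
        simp
    have := Measure.pi_map_pi (μ := fun _ : Fin n => gaussianReal 0 1)
      (f := fun _ x => √(Q : ℝ) * x) (fun _ => by fun_prop)
    simp_rw [hg] at this
    exact this.symm
  rw [blockLaw, stdLaw, ← Measure.map_prod_map _ _ measurable_id (by fun_prop),
    ← Measure.map_prod_map _ _ (by fun_prop) measurable_id, h, Measure.map_id, Measure.map_id]
  rfl

variable [NeZero N₁] [NeZero N₂]

lemma integral_sq_combination {X : Sample n N₁ N₂ → ℝ} {i : Fin n}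
    (hX : MemLp X 2 (stdLaw n N₁ N₂)) (α β : ℝ) :
    ∫ ω, (α * X ω + β * ω.2.1 i) ^ 2 ∂(stdLaw n N₁ N₂) =
      α ^ 2 * ∫ ω, X ω ^ 2 ∂(stdLaw n N₁ N₂) +
        2 * α * β * ∫ ω, X ω * ω.2.1 i ∂(stdLaw n N₁ N₂) + β ^ 2 := by
  have hT := memLp_fst_apply (N₁ := N₁) (N₂ := N₂) i
  have hi : Integrable (fun ω => X ω * ω.2.1 i) (stdLaw n N₁ N₂) := hX.integrable_mul hT
  calc _ = ∫ ω, (α ^ 2 * X ω ^ 2 + 2 * α * β * (X ω * ω.2.1 i) + β ^ 2 * ω.2.1 i ^ 2)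
        ∂(stdLaw n N₁ N₂) := by
        congr 1 with ω
        ring
    _ = _ := by
        rw [integral_linear_combination (hX.integrable_sq.const_mul _) hi hT.integrable_sq,
          integral_const_mul, integral_sq_of_gaussian (measurePreserving_fst_apply i)]
        simp

lemma memLp_two_of_lintegral_sq {Ω : Type*} [MeasurableSpace Ω] {μ : Measure Ω} {X : Ω → ℝ}
    (hX : Measurable X) (h : ∫⁻ ω, ENNReal.ofReal (X ω ^ 2) ∂μ ≠ ∞) : MemLp X 2 μ := by
  rw [memLp_two_iff_integrable_sq hX.aestronglyMeasurable]
  refine ⟨(hX.pow_const 2).aestronglyMeasurable, ?_⟩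
  rw [hasFiniteIntegral_iff_ofReal (ae_of_all _ fun ω => sq_nonneg _)]
  exact h.lt_top

lemma sum_integral_sq_le {Ω : Type*} [MeasurableSpace Ω] {μ : Measure Ω} {X : Fin n → Ω → ℝ}
    (hX : ∀ i, MemLp (X i) 2 μ) {P : ℝ≥0}
    (h : ∑ i, ∫⁻ ω, ENNReal.ofReal (X i ω ^ 2) ∂μ ≤ n * P) :
    ∑ i, ∫ ω, X i ω ^ 2 ∂μ ≤ n * P := by
  have e : ∑ i, ∫⁻ ω, ENNReal.ofReal (X i ω ^ 2) ∂μ = ENNReal.ofReal (∑ i, ∫ ω, X i ω ^ 2 ∂μ) := by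
    rw [ENNReal.ofReal_sum_of_nonneg fun i _ => integral_nonneg fun ω => sq_nonneg _]
    exact Finset.sum_congr rfl fun i _ => (ofReal_integral_eq_lintegral_ofReal
      (hX i).integrable_sq (ae_of_all _ fun ω => sq_nonneg _)).symm
  rw [e] at h
  have := (ENNReal.ofReal_le_iff_le_toReal (by finiteness)).1 h
  simpa using this

/-- Finite-blocklength converse: up to one nat, the rates of a code with correlation `ρ` between the
input of encoder 1 and the normalized state are bounded by the Gaussian expressions. -/
lemma Code.exists_correlation (c : Code n N₁ N₂) (hn : n ≠ 0) {P₁ P₂ Q : ℝ≥0}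
    (hp : c.SatisfiesPower P₁ P₂ Q) :
    ∃ ρ : ℝ, ρ ^ 2 ≤ P₁ ∧
      (1 - (c.errorProb Q).toReal) * Real.log N₁ ≤ n / 2 * Real.log (1 + P₁ - ρ ^ 2) + 1 ∧
      (1 - (c.errorProb Q).toReal) * Real.log N₂ ≤ n / 2 * Real.log (1 + P₂) + 1 ∧
      (1 - (c.errorProb Q).toReal) * (Real.log N₁ + Real.log N₂) ≤
        n / 2 * (Real.log (1 + P₁ - ρ ^ 2) + Real.log (1 + P₁ - ρ ^ 2 + (ρ + √Q) ^ 2 + P₂) -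
          Real.log (1 + P₁ - ρ ^ 2 + (ρ + √Q) ^ 2)) + 1 := by
  set k : ℝ := √(Q : ℝ) with hk
  let φ : Sample n N₁ N₂ → Sample n N₁ N₂ := Prod.map id (Prod.map (fun t => k • t) id)
  have hφ : Measurable φ := by fun_prop
  let x₁ : Fin N₁ → (Fin n → ℝ) → Fin n → ℝ := fun m t => c.enc₁ m (k • t)
  have hx₁ : ∀ m, Measurable (x₁ m) := fun m =>
    (c.measurable_enc₁ m).comp (measurable_id.const_smul k)
  have hin₁ : Measurable c.input₁ := measurable_sample fun m =>
    (c.measurable_enc₁ m.1).comp measurable_fst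
  have hin₂ : Measurable c.input₂ := measurable_sample fun m =>
    (measurable_const : Measurable fun _ => c.enc₂ m.2)
  obtain ⟨hp₁, hp₂⟩ := hp
  have hl : ∀ f : Sample n N₁ N₂ → Fin n → ℝ, Measurable f → ∀ i,
      ∫⁻ ω, ENNReal.ofReal (f ω i ^ 2) ∂(blockLaw n N₁ N₂ Q) =
        ∫⁻ ω, ENNReal.ofReal (f (φ ω) i ^ 2) ∂(stdLaw n N₁ N₂) := fun f hf i => by
    rw [blockLaw_eq_map, lintegral_map (by fun_prop) hφ]
  simp_rw [hl _ hin₁] at hp₁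
  simp_rw [hl _ hin₂] at hp₂
  have hX₁ : ∀ i, MemLp (fun ω => x₁ ω.1.1 ω.2.1 i) 2 (stdLaw n N₁ N₂) := fun i => by
    refine memLp_two_of_lintegral_sq (X := fun ω => c.input₁ (φ ω) i) (by fun_prop) ?_
    have hfin : (n : ℝ≥0∞) * P₁ ≠ ∞ := by finiteness
    exact ne_top_of_le_ne_top hfin ((Finset.single_le_sum (f := fun i => ∫⁻ ω,
      ENNReal.ofReal (c.input₁ (φ ω) i ^ 2) ∂(stdLaw n N₁ N₂)) (fun _ _ => zero_le)
      (Finset.mem_univ i)).trans hp₁)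
  have hX₂ : ∀ i, MemLp (fun ω : Sample n N₁ N₂ => c.enc₂ ω.1.2 i) 2 (stdLaw n N₁ N₂) :=
    fun i => memLp_message fun m => c.enc₂ m i
  have hS₁ : ∑ i, ∫ ω, x₁ ω.1.1 ω.2.1 i ^ 2 ∂(stdLaw n N₁ N₂) ≤ n * P₁ :=
    sum_integral_sq_le hX₁ hp₁
  have hS₂ : ∑ i, ∫ ω, c.enc₂ ω.1.2 i ^ 2 ∂(stdLaw n N₁ N₂) ≤ n * P₂ :=
    sum_integral_sq_le hX₂ hp₂
  have hA : 1 - (c.errorProb Q).toReal = successProb x₁ c.enc₂ k c.dec := by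
    have hout : Measurable c.output := by
      unfold Code.output
      fun_prop
    have hE : MeasurableSet {ω | c.dec (c.output ω) ≠ ω.1} :=
      (measurableSet_eq_fun (c.measurable_dec.comp hout) measurable_fst).compl
    rw [Code.errorProb, blockLaw_eq_map, Measure.map_apply hφ hE, successProb]
    have h := probReal_compl_eq_one_sub (μ := stdLaw n N₁ N₂) (hφ hE)
    rw [measureReal_def (stdLaw n N₁ N₂) (φ ⁻¹' _)] at h
    rw [← h]
    congr 1
    ext ω
    simp only [Set.mem_compl_iff, Set.mem_preimage, Set.mem_ofPred_eq, not_not]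
    rfl
  rw [hA]
  obtain ⟨S, hS⟩ : ∃ S, S = ∑ i, ∫ ω, x₁ ω.1.1 ω.2.1 i ^ 2 ∂(stdLaw n N₁ N₂) := ⟨_, rfl⟩
  obtain ⟨C, hC⟩ : ∃ C, C = ∑ i, ∫ ω, x₁ ω.1.1 ω.2.1 i * ω.2.1 i ∂(stdLaw n N₁ N₂) := ⟨_, rfl⟩
  have hsum : ∀ α β : ℝ, ∑ i, ∫ ω, (α * x₁ ω.1.1 ω.2.1 i + β * ω.2.1 i) ^ 2
      ∂(stdLaw n N₁ N₂) = α ^ 2 * S + 2 * α * β * C + n * β ^ 2 := fun α β => by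
    rw [Finset.sum_congr rfl fun i _ => integral_sq_combination (hX₁ i) α β,
      Finset.sum_add_distrib, Finset.sum_add_distrib, ← Finset.mul_sum, ← Finset.mul_sum, hS, hC]
    simp
  have hn0 : (0 : ℝ) < n := by exact_mod_cast Nat.pos_of_ne_zero hn
  -- ρ is the correlation E[X₁ᵢTᵢ] averaged over the block.
  obtain ⟨ρ, hρ⟩ : ∃ ρ : ℝ, C = n * ρ := ⟨C / n, by field_simp⟩
  rw [← hS] at hS₁
  -- This is the sum of E[(X₁ᵢ − ρTᵢ)²], which gives ρ² ≤ P₁.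
  have hpos : 0 ≤ S - n * ρ ^ 2 := by
    have h := hsum 1 (-ρ)
    have h0 : 0 ≤ ∑ i, ∫ ω, (1 * x₁ ω.1.1 ω.2.1 i + -ρ * ω.2.1 i) ^ 2 ∂(stdLaw n N₁ N₂) :=
      Finset.sum_nonneg fun i _ => integral_nonneg fun ω => sq_nonneg _
    rw [h, hρ] at h0
    linarith
  have hρP : ρ ^ 2 ≤ P₁ := by nlinarith
  obtain ⟨D, hD⟩ : ∃ D : ℝ, D = 1 + P₁ - ρ ^ 2 := ⟨_, rfl⟩
  -- In the extremal Gaussian case, D is the variance of X₁ + Z given T, and v that of X₁ + S + Z.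
  obtain ⟨v, hv⟩ : ∃ v : ℝ, v = D + (ρ + k) ^ 2 := ⟨_, rfl⟩
  have hD0 : 0 < D := by linarith
  have hv0 : 0 < v := by nlinarith [sq_nonneg (ρ + k)]
  have hP₂ : (0 : ℝ) ≤ P₂ := P₂.2
  refine ⟨ρ, hρP, ?_, ?_, ?_⟩
  · have h := successProb_mul_log_fst_le hx₁ c.enc₂ k c.measurable_dec hX₁ ρ hD0
    have e := hsum 1 (-ρ)
    simp only [one_mul, neg_mul, ← sub_eq_add_neg] at e
    rw [e] at h
    have : (1 ^ 2 * S + -(2 * 1 * ρ) * C + n * (-ρ) ^ 2 + n) / (2 * D) ≤ n / 2 := by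
      rw [div_le_iff₀ (by positivity), hρ, hD]
      nlinarith
    rw [← hD]
    refine h.trans ?_
    ring_nf at this ⊢
    linarith
  · have h := successProb_mul_log_snd_le hx₁ c.enc₂ k c.measurable_dec
      (by positivity : (0 : ℝ) < 1 + P₂)
    have : (∑ i, ∫ ω, c.enc₂ ω.1.2 i ^ 2 ∂(stdLaw n N₁ N₂) + n) / (2 * (1 + P₂)) ≤ n / 2 := by
      rw [div_le_iff₀ (by positivity)]
      linarith
    linarith
  -- b is the coefficient of the linear least-squares estimate of T from X₁ + S + Z in the extremal
  -- case, and D / v is its mean square error. The reference variances w = v + P₂ and q = D / v make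
  -- each quadratic term at most n/2.
  · obtain ⟨b, hb⟩ : ∃ b : ℝ, b = (ρ + k) / v := ⟨_, rfl⟩
    have hbv : b * v = ρ + k := by rw [hb]; field_simp
    have hq : 0 < D / v := by positivity
    have h := successProb_mul_log_le hx₁ c.enc₂ k c.measurable_dec hX₁ b
      (by positivity : 0 < v + P₂) hq
    have e₁ := hsum 1 k
    have e₂ := hsum (-b) (1 - b * k)
    have e₃ : ∀ (ω : Sample n N₁ N₂) i, -b * x₁ ω.1.1 ω.2.1 i + (1 - b * k) * ω.2.1 i =
        ω.2.1 i - b * (x₁ ω.1.1 ω.2.1 i + k * ω.2.1 i) := fun ω i => by ring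
    simp only [one_mul] at e₁
    simp_rw [e₃] at e₂
    rw [e₁, e₂] at h
    have h₁ : (1 ^ 2 * S + 2 * 1 * k * C + n * k ^ 2 +
        ∑ i, ∫ ω, c.enc₂ ω.1.2 i ^ 2 ∂(stdLaw n N₁ N₂) + n) / (2 * (v + P₂)) ≤ n / 2 := by
      rw [div_le_iff₀ (by positivity), hρ, hv, hD]
      nlinarith
    have hDv : D / v = 1 - b * (ρ + k) := by
      rw [← hbv, div_eq_iff hv0.ne']
      have : b * (b * v) * v = (ρ + k) ^ 2 := by rw [← hbv]; ring
      linarith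
    have h₂ : ((-b) ^ 2 * S + 2 * -b * (1 - b * k) * C + n * (1 - b * k) ^ 2 + n * b ^ 2) /
        (2 * (D / v)) ≤ n / 2 := by
      rw [div_le_iff₀ (by positivity), hDv, hρ]
      have hb2 : b ^ 2 * S ≤ b ^ 2 * (n * P₁) := by gcongr
      have : n * b * (b * v) = n * b * (ρ + k) := by rw [hbv]
      rw [hv, hD] at this
      linarith
    rw [← hD, ← hv, ← Real.log_mul (by simp [NeZero.ne]) (by simp [NeZero.ne])]
    rw [Real.log_div hD0.ne' hv0.ne'] at h
    ring_nf at h h₁ h₂ ⊢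
    linarith

end Converse

/-! ### Divergence between Gaussian kernels. -/

section GaussianKernel

variable {α : Type*} [MeasurableSpace α]

/-- The kernel `a ↦ N(f a, v)`. -/
def gaussKernel (f : α → ℝ) (hf : Measurable f) (v : ℝ≥0) : Kernel α ℝ where
  toFun a := gaussianReal (f a) v
  measurable' := measurable_gaussianReal.comp (hf.prodMk measurable_const)

lemma gaussKernel_apply {f : α → ℝ} (hf : Measurable f) (v : ℝ≥0) (a : α) :
    gaussKernel f hf v a = gaussianReal (f a) v := rfl

instance (f : α → ℝ) (hf : Measurable f) (v : ℝ≥0) : IsMarkovKernel (gaussKernel f hf v) :=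
  ⟨fun a => by rw [gaussKernel_apply]; infer_instance⟩

lemma lintegral_gaussianReal_add_const {m : ℝ} {v : ℝ≥0} {F : ℝ → ℝ≥0∞} (hF : Measurable F)
    (c : ℝ) : ∫⁻ x, F (x + c) ∂(gaussianReal m v) = ∫⁻ x, F x ∂(gaussianReal (m + c) v) := by
  rw [← gaussianReal_map_add_const, lintegral_map hF (by fun_prop)]

lemma lintegral_gaussianReal_add {m₁ m₂ : ℝ} {v₁ v₂ : ℝ≥0} {F : ℝ → ℝ≥0∞} (hF : Measurable F) :
    ∫⁻ x, ∫⁻ z, F (x + z) ∂(gaussianReal m₂ v₂) ∂(gaussianReal m₁ v₁) =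
      ∫⁻ x, F x ∂(gaussianReal (m₁ + m₂) (v₁ + v₂)) := by
  rw [← gaussianReal_conv_gaussianReal, Measure.lintegral_conv hF]

lemma measurePreserving_sub_gaussKernel (A : Measure α) [IsProbabilityMeasure A] {f : α → ℝ}
    (hf : Measurable f) (v : ℝ≥0) :
    MeasurePreserving (fun p => p.2 - f p.1) (A ⊗ₘ gaussKernel f hf v) (gaussianReal 0 v) := by
  refine ⟨by fun_prop, Measure.ext_of_lintegral _ fun F hF => ?_⟩
  rw [lintegral_map hF (by fun_prop), Measure.lintegral_compProd (by fun_prop)]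
  have : ∀ a, ∫⁻ y, F (y - f a) ∂(gaussKernel f hf v a) = ∫⁻ y, F y ∂(gaussianReal 0 v) :=
    fun a => by
      simp_rw [gaussKernel_apply, sub_eq_add_neg]
      rw [lintegral_gaussianReal_add_const hF, add_neg_cancel]
  simp [this]

/-- Log-likelihood ratio of `N(f a, r)` to `N(g a, ρ)`. -/
def gaussLLR (f g : α → ℝ) (r ρ : ℝ≥0) (p : α × ℝ) : ℝ :=
  (-(Real.log (2 * Real.pi * r) / 2) - (p.2 - f p.1) ^ 2 / (2 * r)) -
    (-(Real.log (2 * Real.pi * ρ) / 2) - (p.2 - g p.1) ^ 2 / (2 * ρ))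

variable {f g : α → ℝ} {r ρ : ℝ≥0}

lemma measurable_gaussLLR (hf : Measurable f) (hg : Measurable g) :
    Measurable (gaussLLR f g r ρ) := by
  unfold gaussLLR
  fun_prop

lemma compProd_gaussKernel_eq_withDensity (hf : Measurable f) (hg : Measurable g) (A : Measure α)
    [IsProbabilityMeasure A] (hr : r ≠ 0) (hρ : ρ ≠ 0) :
    A ⊗ₘ gaussKernel f hf r = (A ⊗ₘ gaussKernel g hg ρ).withDensity
      fun p => ENNReal.ofReal (Real.exp (gaussLLR f g r ρ p)) := by
  have hm := measurable_gaussLLR hf hg (r := r) (ρ := ρ)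
  refine Measure.ext_of_lintegral _ fun F hF => ?_
  rw [lintegral_withDensity_eq_lintegral_mul _ (by fun_prop) hF,
    Measure.lintegral_compProd hF, Measure.lintegral_compProd (by fun_prop)]
  refine lintegral_congr fun a => ?_
  rw [gaussKernel_apply, gaussKernel_apply, gaussianReal_of_var_ne_zero _ hr,
    gaussianReal_of_var_ne_zero _ hρ,
    lintegral_withDensity_eq_lintegral_mul _ (measurable_gaussianPDF _ _) (by fun_prop),
    lintegral_withDensity_eq_lintegral_mul _ (measurable_gaussianPDF _ _) (by fun_prop)]
  refine lintegral_congr fun y => ?_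
  simp only [Pi.mul_apply, gaussianPDF_eq_exp hr, gaussianPDF_eq_exp hρ]
  rw [← mul_assoc, ← ENNReal.ofReal_mul (Real.exp_pos _).le, ← Real.exp_add]
  congr 3
  unfold gaussLLR
  ring

/-- Under the first law both residuals have exactly the variances of their kernels, so the two
quadratic terms of the log-likelihood ratio average to 1/2 each and cancel; the normalizing
constants remain. -/
lemma le_klDiv_compProd_gaussKernel (hf : Measurable f) (hg : Measurable g) (A : Measure α)
    [IsProbabilityMeasure A] (hr : r ≠ 0) (hρ : ρ ≠ 0)
    (h : MeasurePreserving (fun p => p.2 - g p.1) (A ⊗ₘ gaussKernel f hf r) (gaussianReal 0 ρ)) :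
    ENNReal.ofReal ((Real.log ρ - Real.log r) / 2) ≤
      klDiv (A ⊗ₘ gaussKernel f hf r) (A ⊗ₘ gaussKernel g hg ρ) := by
  have hd := compProd_gaussKernel_eq_withDensity hf hg A hr hρ
  have hm := measurable_gaussLLR hf hg (r := r) (ρ := ρ)
  have hr0 : (0 : ℝ) < r := NNReal.coe_pos.2 (pos_iff_ne_zero.2 hr)
  have hρ0 : (0 : ℝ) < ρ := NNReal.coe_pos.2 (pos_iff_ne_zero.2 hρ)
  set P := A ⊗ₘ gaussKernel f hf r with hP
  set R := A ⊗ₘ gaussKernel g hg ρ with hR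
  have hac : P ≪ R := hd ▸ withDensity_absolutelyContinuous _ _
  -- Without integrability the divergence is `∞`, so a lower bound needs no proof of it.
  by_cases hint : Integrable (llr P R) P
  swap
  · simp [klDiv_of_not_integrable hint]
  have hllr : llr P R =ᵐ[P] gaussLLR f g r ρ := by
    have h1 : P.rnDeriv R =ᵐ[R] fun p => ENNReal.ofReal (Real.exp (gaussLLR f g r ρ p)) := by
      rw [hd]
      exact Measure.rnDeriv_withDensity R (by fun_prop)
    filter_upwards [hac.ae_eq h1] with p hp
    rw [llr, hp, ENNReal.toReal_ofReal (Real.exp_pos _).le, Real.log_exp]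
  rw [klDiv_of_ac_of_integrable hac hint, integral_congr_ae hllr]
  refine ENNReal.ofReal_le_ofReal (le_of_eq ?_)
  have hf' := measurePreserving_sub_gaussKernel A hf r
  rw [← hP] at hf'
  have hi₁ := (memLp_two_of_gaussian hf').integrable_sq
  have hi₂ := (memLp_two_of_gaussian h).integrable_sq
  have e : ∀ p, gaussLLR f g r ρ p = (Real.log ρ - Real.log r) / 2 +
      (-1 / (2 * r)) * (p.2 - f p.1) ^ 2 + (1 / (2 * ρ)) * (p.2 - g p.1) ^ 2 := fun p => by
    rw [gaussLLR, log_two_pi_mul hr0, log_two_pi_mul hρ0]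
    ring
  simp_rw [e]
  rw [integral_linear_combination (integrable_const _) hi₁ hi₂, integral_sq_of_gaussian hf',
    integral_sq_of_gaussian h]
  simp
  field_simp
  ring

end GaussianKernel

/-! ### Lower bounds on mutual informations from Gaussian output laws. -/

section MutualInformation

variable {Ω γ : Type*} [MeasurableSpace Ω] [MeasurableSpace γ] {μ : Measure Ω}
  [IsProbabilityMeasure μ] {X Y : Ω → ℝ} {r ρ : ℝ≥0}

lemma le_mutualInfo_of_gaussian (hX : Measurable X) (hY : Measurable Y) (hr : r ≠ 0) (hρ : ρ ≠ 0)
    {f : ℝ → ℝ} (hf : Measurable f) {m : ℝ}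
    (hXY : μ.map (fun ω => (X ω, Y ω)) = μ.map X ⊗ₘ gaussKernel f hf r)
    (hYlaw : μ.map Y = gaussianReal m ρ) :
    ENNReal.ofReal ((Real.log ρ - Real.log r) / 2) ≤ mutualInfo X Y μ := by
  have := Measure.isProbabilityMeasure_map (μ := μ) hX.aemeasurable
  have hprod : (μ.map X).prod (μ.map Y) = μ.map X ⊗ₘ gaussKernel (fun _ => m) measurable_const ρ := by
    rw [hYlaw, ← Measure.compProd_const]
    rfl
  rw [mutualInfo, hXY, hprod]
  refine le_klDiv_compProd_gaussKernel hf measurable_const _ hr hρ ?_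
  rw [← hXY]
  refine ⟨by fun_prop, ?_⟩
  rw [Measure.map_map (by fun_prop) (by fun_prop)]
  have : (fun p : ℝ × ℝ => p.2 - m) ∘ (fun ω => (X ω, Y ω)) = (fun y => y - m) ∘ Y := rfl
  rw [this, ← Measure.map_map (by fun_prop) hY, hYlaw, gaussianReal_map_sub_const, sub_self]

/-- The law of X given W need not be identified: after regrouping (W, (X, Y)) as ((W, X), Y), the
product kernel becomes the law of (W, X) followed by a Gaussian kernel that reads only W. -/
lemma le_condMutualInfo_of_gaussian {W : Ω → γ} (hX : Measurable X) (hY : Measurable Y)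
    (hW : Measurable W) (hr : r ≠ 0) (hρ : ρ ≠ 0) {f : γ × ℝ → ℝ} (hf : Measurable f)
    {g : γ → ℝ} (hg : Measurable g)
    (hXY : μ.map (fun ω => ((W ω, X ω), Y ω)) = μ.map (fun ω => (W ω, X ω)) ⊗ₘ gaussKernel f hf r)
    (hWY : μ.map (fun ω => (W ω, Y ω)) = μ.map W ⊗ₘ gaussKernel g hg ρ) :
    ENNReal.ofReal ((Real.log ρ - Real.log r) / 2) ≤ condMutualInfo X Y W μ := by
  have := Measure.isProbabilityMeasure_map (μ := μ) hW.aemeasurable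
  have := Measure.isProbabilityMeasure_map (μ := μ) (hW.prodMk hX).aemeasurable
  have hk : condDistrib Y W μ =ᵐ[μ.map W] gaussKernel g hg ρ :=
    condDistrib_ae_eq_of_measure_eq_compProd W hY.aemeasurable hWY
  have hR : μ.map W ⊗ₘ (condDistrib X W μ ×ₖ condDistrib Y W μ) =
      μ.map W ⊗ₘ (condDistrib X W μ ×ₖ gaussKernel g hg ρ) := by
    refine Measure.compProd_congr ?_
    filter_upwards [hk] with w hw
    rw [Kernel.prod_apply, Kernel.prod_apply, hw]
  have hassoc : Measurable fun p : γ × ℝ × ℝ => ((p.1, p.2.1), p.2.2) := by fun_prop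
  have hRmap : (μ.map W ⊗ₘ (condDistrib X W μ ×ₖ gaussKernel g hg ρ)).map
      (fun p : γ × ℝ × ℝ => ((p.1, p.2.1), p.2.2)) =
      μ.map (fun ω => (W ω, X ω)) ⊗ₘ gaussKernel (fun p => g p.1) (hg.comp measurable_fst) ρ := by
    rw [← compProd_map_condDistrib hX.aemeasurable]
    refine Measure.ext_of_lintegral _ fun F hF => ?_
    rw [lintegral_map hF hassoc, Measure.lintegral_compProd (by fun_prop),
      Measure.lintegral_compProd hF, Measure.lintegral_compProd
        (Measurable.lintegral_kernel_prod_right' hF)]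
    refine lintegral_congr fun w => ?_
    rw [Kernel.prod_apply, lintegral_prod _ (by fun_prop)]
    rfl
  have hP : (μ.map fun ω => (W ω, X ω, Y ω)).map (fun p : γ × ℝ × ℝ => ((p.1, p.2.1), p.2.2)) =
      μ.map (fun ω => (W ω, X ω)) ⊗ₘ gaussKernel f hf r := by
    rw [Measure.map_map hassoc (by fun_prop), ← hXY]
    rfl
  rw [condMutualInfo, hR]
  -- Data processing for the regrouping map; only this direction is needed for a lower bound.
  refine le_trans ?_ (klDiv_map_le _ _ hassoc)
  rw [hP, hRmap]
  refine le_klDiv_compProd_gaussKernel hf _ _ hr hρ ?_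
  rw [← hXY]
  refine ⟨by fun_prop, ?_⟩
  have h := (measurePreserving_sub_gaussKernel (μ.map W) hg ρ).map_eq
  rw [← hWY, Measure.map_map (by fun_prop) (by fun_prop)] at h
  rw [Measure.map_map (by fun_prop) (by fun_prop), ← h]
  rfl

end MutualInformation

/-! ### Output laws and informations for Gaussian inputs. -/

section Letter

/-- The conditional law of `X₁ = a S + N(0, τ)` given `S`. -/
def linKernel (a : ℝ) (τ : ℝ≥0) : Kernel ℝ ℝ := gaussKernel (fun s => a * s) (by fun_prop) τ

instance (a : ℝ) (τ : ℝ≥0) : IsMarkovKernel (linKernel a τ) := by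
  unfold linKernel; infer_instance

@[fun_prop]
lemma measurable_state : Measurable state := by unfold state; fun_prop

@[fun_prop]
lemma measurable_inp₁ : Measurable inp₁ := by unfold inp₁; fun_prop

@[fun_prop]
lemma measurable_inp₂ : Measurable inp₂ := by unfold inp₂; fun_prop

@[fun_prop]
lemma measurable_noise : Measurable noise := by unfold noise; fun_prop

@[fun_prop]
lemma measurable_out : Measurable out := by unfold out; fun_prop

variable (Q P : ℝ≥0) (a : ℝ) (τ : ℝ≥0)

lemma lintegral_letterLaw {F : ((ℝ × ℝ) × ℝ) × ℝ → ℝ≥0∞} (hF : Measurable F) :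
    ∫⁻ ω, F ω ∂(letterLaw Q (linKernel a τ) (gaussianReal 0 P)) =
      ∫⁻ s, ∫⁻ x₁, ∫⁻ x₂, ∫⁻ z, F (((s, x₁), x₂), z) ∂(gaussianReal 0 1) ∂(gaussianReal 0 P)
        ∂(gaussianReal (a * s) τ) ∂(gaussianReal 0 Q) := by
  rw [letterLaw, lintegral_prod _ hF.aemeasurable,
    lintegral_prod _ hF.lintegral_prod_right'.aemeasurable,
    Measure.lintegral_compProd hF.lintegral_prod_right'.lintegral_prod_right']
  rfl

/-- `X₁ + b S` is Gaussian. -/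
lemma lintegral_linKernel {F : ℝ → ℝ≥0∞} (hF : Measurable F) (b : ℝ) :
    ∫⁻ s, ∫⁻ x₁, F (x₁ + b * s) ∂(gaussianReal (a * s) τ) ∂(gaussianReal 0 Q) =
      ∫⁻ x, F x ∂(gaussianReal 0 (‖a + b‖₊ ^ 2 * Q + τ)) := by
  -- X₁ + bS is rewritten as (a + b)S + G with G ∼ N(0, τ) independent of S.
  have h : ∀ s, ∫⁻ x₁, F (x₁ + b * s) ∂(gaussianReal (a * s) τ) =
      ∫⁻ g, F ((a + b) * s + g) ∂(gaussianReal 0 τ) := fun s => by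
    have h1 := lintegral_gaussianReal_add_const (m := 0) (v := τ) hF ((a + b) * s)
    rw [lintegral_gaussianReal_add_const hF (b * s), ← add_mul, ← zero_add ((a + b) * s), ← h1]
    simp_rw [zero_add, add_comm]
  have hm : Measurable fun x => ∫⁻ g, F (x + g) ∂(gaussianReal 0 τ) :=
    Measurable.lintegral_prod_right' (f := fun p : ℝ × ℝ => F (p.1 + p.2)) (by fun_prop)
  have hQ : (gaussianReal 0 Q).map (fun s => (a + b) * s) =
      gaussianReal 0 (‖a + b‖₊ ^ 2 * Q) := by
    rw [gaussianReal_map_const_mul, mul_zero]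
    congr 2
    ext
    simp
  simp_rw [h]
  rw [← lintegral_map (f := fun x => ∫⁻ g, F (x + g) ∂(gaussianReal 0 τ))
    (g := fun s => (a + b) * s) hm (by fun_prop), hQ, lintegral_gaussianReal_add hF, zero_add]

lemma lintegral_sq_gaussianReal (v : ℝ≥0) :
    ∫⁻ x, ENNReal.ofReal (x ^ 2) ∂(gaussianReal 0 v) = v := by
  have h := ofReal_integral_eq_lintegral_ofReal (μ := gaussianReal 0 v) (f := fun x => x ^ 2)
    (memLp_two_of_gaussian (.id _)).integrable_sq (ae_of_all _ fun x => sq_nonneg x)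
  rw [← h, integral_sq_gaussianReal]
  simp

lemma lintegral_inp₁_sq :
    ∫⁻ ω, ENNReal.ofReal (inp₁ ω ^ 2) ∂(letterLaw Q (linKernel a τ) (gaussianReal 0 P)) =
      ‖a‖₊ ^ 2 * Q + τ := by
  rw [lintegral_letterLaw _ _ _ _ (by fun_prop)]
  simp only [inp₁, lintegral_const, measure_univ, mul_one]
  have h := lintegral_linKernel Q a τ (F := fun x => ENNReal.ofReal (x ^ 2)) (by fun_prop) 0
  simp only [zero_mul, add_zero] at h
  rw [h, lintegral_sq_gaussianReal]
  push_cast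
  rfl

lemma lintegral_inp₂_sq :
    ∫⁻ ω, ENNReal.ofReal (inp₂ ω ^ 2) ∂(letterLaw Q (linKernel a τ) (gaussianReal 0 P)) = P := by
  rw [lintegral_letterLaw _ _ _ _ (by fun_prop)]
  simp only [inp₂, lintegral_const, measure_univ, mul_one]
  exact lintegral_sq_gaussianReal P

lemma lintegral_map_compProd_gaussKernel {Ω α : Type*} [MeasurableSpace Ω] [MeasurableSpace α]
    {μ : Measure Ω} [IsProbabilityMeasure μ] {W : Ω → α} (hW : Measurable W) {g : α → ℝ}
    (hg : Measurable g) (v : ℝ≥0) {F : α × ℝ → ℝ≥0∞} (hF : Measurable F) :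
    ∫⁻ p, F p ∂(μ.map W ⊗ₘ gaussKernel g hg v) =
      ∫⁻ ω, ∫⁻ y, F (W ω, y) ∂(gaussianReal (g (W ω)) v) ∂μ := by
  rw [Measure.lintegral_compProd hF, lintegral_map (Measurable.lintegral_kernel_prod_right' hF) hW]
  rfl

@[fun_prop]
lemma measurable_lintegral_gaussianReal {α : Type*} [MeasurableSpace α] {F : α × ℝ → ℝ≥0∞}
    (hF : Measurable F) {g : α → ℝ} (hg : Measurable g) (v : ℝ≥0) :
    Measurable fun a => ∫⁻ y, F (a, y) ∂(gaussianReal (g a) v) :=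
  Measurable.lintegral_kernel_prod_right' (κ := gaussKernel g hg v) hF

lemma lintegral_gaussianReal_const_add {m : ℝ} {v : ℝ≥0} {F : ℝ → ℝ≥0∞} (hF : Measurable F)
    (c : ℝ) : ∫⁻ x, F (c + x) ∂(gaussianReal m v) = ∫⁻ x, F x ∂(gaussianReal (c + m) v) := by
  simp_rw [add_comm c]
  exact lintegral_gaussianReal_add_const hF c

/-- Given everything but the noise, the output is Gaussian with unit variance. -/
lemma map_out_of_inputs {α : Type*} [MeasurableSpace α] {U : ((ℝ × ℝ) × ℝ) × ℝ → α}
    (hU : Measurable U) (hU' : ∀ b z, U (b, z) = U (b, 0)) {f : α → ℝ} (hf : Measurable f)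
    (hfU : ∀ ω, f (U ω) = inp₁ ω + inp₂ ω + state ω) :
    (letterLaw Q (linKernel a τ) (gaussianReal 0 P)).map (fun ω => (U ω, out ω)) =
      (letterLaw Q (linKernel a τ) (gaussianReal 0 P)).map U ⊗ₘ gaussKernel f hf 1 := by
  refine Measure.ext_of_lintegral _ fun F hF => ?_
  have hFm : Measurable fun ω => ∫⁻ y, F (U ω, y) ∂(gaussianReal (f (U ω)) 1) :=
    measurable_lintegral_gaussianReal (F := fun p : (((ℝ × ℝ) × ℝ) × ℝ) × ℝ => F (U p.1, p.2))
      (by fun_prop) (hf.comp hU) 1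
  rw [lintegral_map hF (by fun_prop), lintegral_map_compProd_gaussKernel hU hf 1 hF,
    lintegral_letterLaw _ _ _ _ (by fun_prop), lintegral_letterLaw _ _ _ _ hFm]
  refine lintegral_congr fun s => lintegral_congr fun x₁ => lintegral_congr fun x₂ => ?_
  simp only [hfU]
  simp only [inp₁, inp₂, state, out, noise]
  have h : ∀ z, U (((s, x₁), x₂), z) = U (((s, x₁), x₂), 0) := hU' _
  simp_rw [h]
  rw [lintegral_const, measure_univ, mul_one,
    lintegral_gaussianReal_const_add (F := fun y => F (U (((s, x₁), x₂), 0), y)) (by fun_prop),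
    add_zero]

lemma map_out_of_inp₁_state :
    (letterLaw Q (linKernel a τ) (gaussianReal 0 P)).map
        (fun ω => ((inp₁ ω, state ω), out ω)) =
      (letterLaw Q (linKernel a τ) (gaussianReal 0 P)).map (fun ω => (inp₁ ω, state ω)) ⊗ₘ
        gaussKernel (fun w : ℝ × ℝ => w.1 + w.2) (by fun_prop) (P + 1) := by
  refine Measure.ext_of_lintegral _ fun F hF => ?_
  rw [lintegral_map hF (by fun_prop), lintegral_map_compProd_gaussKernel (by fun_prop) _ _ hF,
    lintegral_letterLaw _ _ _ _ (by fun_prop), lintegral_letterLaw _ _ _ _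
      (measurable_lintegral_gaussianReal (F := fun p : (((ℝ × ℝ) × ℝ) × ℝ) × ℝ =>
        F ((inp₁ p.1, state p.1), p.2)) (by fun_prop) (by fun_prop) _)]
  refine lintegral_congr fun s => lintegral_congr fun x₁ => ?_
  simp only [inp₁, inp₂, state, out, noise, lintegral_const, measure_univ, mul_one]
  have h := lintegral_gaussianReal_add (m₁ := 0) (m₂ := 0) (v₁ := P) (v₂ := 1)
    (F := fun y => F ((x₁, s), (x₁ + s) + y)) (by fun_prop)
  rw [lintegral_gaussianReal_const_add (F := fun y => F ((x₁, s), y)) (by fun_prop)] at h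
  simp only [add_zero] at h
  rw [← h]
  refine lintegral_congr fun x₂ => lintegral_congr fun z => ?_
  congr 2
  ring

lemma map_out_of_inp₂_state :
    (letterLaw Q (linKernel a τ) (gaussianReal 0 P)).map
        (fun ω => ((inp₂ ω, state ω), out ω)) =
      (letterLaw Q (linKernel a τ) (gaussianReal 0 P)).map (fun ω => (inp₂ ω, state ω)) ⊗ₘ
        gaussKernel (fun w : ℝ × ℝ => w.1 + w.2 + a * w.2) (by fun_prop) (τ + 1) := by
  refine Measure.ext_of_lintegral _ fun F hF => ?_
  rw [lintegral_map hF (by fun_prop), lintegral_map_compProd_gaussKernel (by fun_prop) _ _ hF,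
    lintegral_letterLaw _ _ _ _ (by fun_prop), lintegral_letterLaw _ _ _ _
      (measurable_lintegral_gaussianReal (F := fun p : (((ℝ × ℝ) × ℝ) × ℝ) × ℝ =>
        F ((inp₂ p.1, state p.1), p.2)) (by fun_prop) (by fun_prop) _)]
  refine lintegral_congr fun s => ?_
  simp only [inp₁, inp₂, state, out, noise, lintegral_const, measure_univ, mul_one]
  -- X₂ is conditioned on, so X₁ must be integrated inside it before being merged with the noise.
  rw [lintegral_lintegral_swap]
  · refine lintegral_congr fun x₂ => ?_
    have h := lintegral_gaussianReal_add (m₁ := a * s) (m₂ := 0) (v₁ := τ) (v₂ := 1)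
      (F := fun y => F ((x₂, s), (x₂ + s) + y)) (by fun_prop)
    rw [lintegral_gaussianReal_const_add (F := fun y => F ((x₂, s), y)) (by fun_prop)] at h
    simp only [add_zero] at h
    rw [← h]
    refine lintegral_congr fun x₁ => lintegral_congr fun z => ?_
    congr 2
    ring
  · refine (Measurable.lintegral_prod_right' (f := fun p : (ℝ × ℝ) × ℝ =>
      F ((p.1.2, s), p.1.1 + p.1.2 + s + p.2)) (by fun_prop)).aemeasurable

lemma map_inp₂_out :
    (letterLaw Q (linKernel a τ) (gaussianReal 0 P)).map (fun ω => (inp₂ ω, out ω)) =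
      (letterLaw Q (linKernel a τ) (gaussianReal 0 P)).map inp₂ ⊗ₘ
        gaussKernel (fun x => x) measurable_id (‖a + 1‖₊ ^ 2 * Q + τ + 1) := by
  refine Measure.ext_of_lintegral _ fun F hF => ?_
  rw [lintegral_map hF (by fun_prop), lintegral_map_compProd_gaussKernel (by fun_prop) _ _ hF,
    lintegral_letterLaw _ _ _ _ (by fun_prop), lintegral_letterLaw _ _ _ _
      (measurable_lintegral_gaussianReal (F := fun p : (((ℝ × ℝ) × ℝ) × ℝ) × ℝ =>
        F (inp₂ p.1, p.2)) (by fun_prop) (by fun_prop) _)]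
  simp only [inp₁, inp₂, state, out, noise, lintegral_const, measure_univ, mul_one]
  have hm : Measurable fun u => ∫⁻ x₂, ∫⁻ z, F (x₂, x₂ + (u + z)) ∂(gaussianReal 0 1)
      ∂(gaussianReal 0 P) :=
    Measurable.lintegral_prod_right' (f := fun q : ℝ × ℝ => ∫⁻ z, F (q.2, q.2 + (q.1 + z))
      ∂(gaussianReal 0 1)) (Measurable.lintegral_prod_right'
        (f := fun p : (ℝ × ℝ) × ℝ => F (p.1.2, p.1.2 + (p.1.1 + p.2))) (by fun_prop))
  have h := lintegral_linKernel Q a τ hm 1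
  have e : ∀ s x₁ x₂ z : ℝ, x₁ + x₂ + s + z = x₂ + (x₁ + 1 * s + z) := fun _ _ _ _ => by ring
  simp_rw [e]
  rw [h, lintegral_lintegral_swap]
  · refine lintegral_congr fun x₂ => ?_
    rw [lintegral_gaussianReal_add (F := fun y => F (x₂, x₂ + y)) (by fun_prop),
      lintegral_gaussianReal_const_add (F := fun y => F (x₂, y)) (by fun_prop)]
    simp
  · exact (Measurable.lintegral_prod_right'
        (f := fun p : (ℝ × ℝ) × ℝ => F (p.1.2, p.1.2 + (p.1.1 + p.2))) (by fun_prop)).aemeasurable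

lemma map_out : (letterLaw Q (linKernel a τ) (gaussianReal 0 P)).map out =
    gaussianReal 0 (P + (‖a + 1‖₊ ^ 2 * Q + τ + 1)) := by
  refine Measure.ext_of_lintegral _ fun F hF => ?_
  have h := congrArg (fun ν => ∫⁻ p, F p.2 ∂ν) (map_inp₂_out Q P a τ)
  rw [lintegral_map (by fun_prop) (by fun_prop),
    lintegral_map_compProd_gaussKernel (by fun_prop) _ _ (by fun_prop),
    lintegral_letterLaw _ _ _ _ (measurable_lintegral_gaussianReal
      (F := fun p : (((ℝ × ℝ) × ℝ) × ℝ) × ℝ => F p.2) (by fun_prop) (by fun_prop) _)] at h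
  rw [lintegral_map hF (by fun_prop), h]
  simp only [inp₂, lintegral_const, measure_univ, mul_one]
  have h2 := lintegral_gaussianReal_add (m₁ := 0) (m₂ := 0) (v₁ := P)
    (v₂ := ‖a + 1‖₊ ^ 2 * Q + τ + 1) hF
  simp only [add_zero] at h2
  rw [← h2]
  refine lintegral_congr fun x => ?_
  rw [lintegral_gaussianReal_const_add hF, add_zero]

/-- Given (X₂, S), learning X₁ lowers the variance of Y from τ + 1 to 1. -/
lemma le_condMutualInfo_inp₁ :
    ENNReal.ofReal (Real.log (1 + τ) / 2) ≤ condMutualInfo inp₁ out (fun ω => (inp₂ ω, state ω))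
      (letterLaw Q (linKernel a τ) (gaussianReal 0 P)) := by
  have h := le_condMutualInfo_of_gaussian (X := inp₁) (Y := out)
    (W := fun ω => (inp₂ ω, state ω)) (r := 1) (by fun_prop) (by fun_prop) (by fun_prop) one_ne_zero
    (add_pos_of_nonneg_of_pos zero_le one_pos).ne'
    (f := fun p => p.2 + p.1.1 + p.1.2) (by fun_prop) _
    (map_out_of_inputs Q P a τ (by fun_prop) (fun _ _ => rfl) _ fun _ => rfl)
    (map_out_of_inp₂_state Q P a τ)
  simpa [add_comm] using h

lemma le_condMutualInfo_inp₂ :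
    ENNReal.ofReal (Real.log (1 + P) / 2) ≤ condMutualInfo inp₂ out (fun ω => (inp₁ ω, state ω))
      (letterLaw Q (linKernel a τ) (gaussianReal 0 P)) := by
  have h := le_condMutualInfo_of_gaussian (X := inp₂) (Y := out)
    (W := fun ω => (inp₁ ω, state ω)) (r := 1) (by fun_prop) (by fun_prop) (by fun_prop) one_ne_zero
    (add_pos_of_nonneg_of_pos zero_le one_pos).ne'
    (f := fun p => p.1.1 + p.2 + p.1.2) (by fun_prop) _
    (map_out_of_inputs Q P a τ (by fun_prop) (fun _ _ => rfl) _ fun _ => rfl)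
    (map_out_of_inp₁_state Q P a τ)
  simpa [add_comm] using h

/-- X₁ + S + Z = (a + 1)S + N(0, τ) + Z acts as Gaussian noise independent of X₂. -/
lemma le_mutualInfo_inp₂ :
    ENNReal.ofReal ((Real.log (1 + τ + (a + 1) ^ 2 * Q + P) -
        Real.log (1 + τ + (a + 1) ^ 2 * Q)) / 2) ≤
      mutualInfo inp₂ out (letterLaw Q (linKernel a τ) (gaussianReal 0 P)) := by
  have h := le_mutualInfo_of_gaussian (X := inp₂) (Y := out) (by fun_prop) (by fun_prop)
    (add_pos_of_nonneg_of_pos zero_le one_pos).ne' (add_pos_of_nonneg_of_pos zero_le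
      (add_pos_of_nonneg_of_pos zero_le one_pos)).ne' measurable_id
    (map_inp₂_out Q P a τ) (map_out Q P a τ)
  refine le_of_eq_of_le ?_ h
  push_cast
  simp only [Real.norm_eq_abs, sq_abs]
  congr 4 <;> ring

end Letter

/-! ### The Gaussian region between the capacity region and the single-letter region. -/

section Region

/-- Bound on the sum rate for Gaussian inputs, with correlation `ρ` between the input of encoder 1
and the normalized state. -/
def sumBound (P₁ P₂ Q : ℝ≥0) (ρ : ℝ) : ℝ :=
  (Real.log (1 + P₁ - ρ ^ 2) + Real.log (1 + P₁ - ρ ^ 2 + (ρ + √Q) ^ 2 + P₂) -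
    Real.log (1 + P₁ - ρ ^ 2 + (ρ + √Q) ^ 2)) / 2

/-- Rate pairs which satisfy the bounds for Gaussian inputs with some correlation `ρ`. -/
def gaussRegion (P₁ P₂ Q : ℝ≥0) : Set (ℝ × ℝ) :=
  {R | ∃ ρ : ℝ, ρ ^ 2 ≤ P₁ ∧ R.1 ≤ Real.log (1 + P₁ - ρ ^ 2) / 2 ∧
    R.2 ≤ Real.log (1 + P₂) / 2 ∧ R.1 + R.2 ≤ sumBound P₁ P₂ Q ρ}

/-- The region is the projection of a closed set along the compact interval [−√P₁, √P₁] of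
correlations. On it 1 + P₁ − ρ² ≥ 1, so all the logarithms are continuous. -/
lemma isClosed_gaussRegion (P₁ P₂ Q : ℝ≥0) : IsClosed (gaussRegion P₁ P₂ Q) := by
  let K : Set ℝ := Set.Icc (-√(P₁ : ℝ)) √(P₁ : ℝ)
  have hK : ∀ ρ : ℝ, ρ ∈ K ↔ ρ ^ 2 ≤ P₁ := fun ρ => (Real.sq_le P₁.2).symm
  have : CompactSpace K := isCompact_iff_compactSpace.1 isCompact_Icc
  have hP₂ : (0 : ℝ) ≤ P₂ := P₂.2
  have hpos : ∀ p : K × (ℝ × ℝ), 0 < 1 + (P₁ : ℝ) - (p.1 : ℝ) ^ 2 := fun p => by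
    linarith [(hK p.1).1 p.1.2]
  have hpos₁ : ∀ p : K × (ℝ × ℝ), 0 < 1 + (P₁ : ℝ) - (p.1 : ℝ) ^ 2 + (p.1 + √Q) ^ 2 := fun p =>
    add_pos_of_pos_of_nonneg (hpos p) (sq_nonneg _)
  have hc : Continuous fun p : K × (ℝ × ℝ) => Real.log (1 + P₁ - (p.1 : ℝ) ^ 2) :=
    Continuous.log (by fun_prop) fun p => (hpos p).ne'
  have hc₁ : Continuous fun p : K × (ℝ × ℝ) =>
      Real.log (1 + P₁ - (p.1 : ℝ) ^ 2 + (p.1 + √Q) ^ 2) :=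
    Continuous.log (by fun_prop) fun p => (hpos₁ p).ne'
  have hc₂ : Continuous fun p : K × (ℝ × ℝ) =>
      Real.log (1 + P₁ - (p.1 : ℝ) ^ 2 + (p.1 + √Q) ^ 2 + P₂) :=
    Continuous.log (by fun_prop) fun p => (add_pos_of_pos_of_nonneg (hpos₁ p) hP₂).ne'
  have hcs : Continuous fun p : K × (ℝ × ℝ) => sumBound P₁ P₂ Q p.1 := by
    unfold sumBound
    fun_prop
  have hT : IsClosed {p : K × (ℝ × ℝ) | p.2.1 ≤ Real.log (1 + P₁ - (p.1 : ℝ) ^ 2) / 2 ∧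
      p.2.2 ≤ Real.log (1 + P₂) / 2 ∧ p.2.1 + p.2.2 ≤ sumBound P₁ P₂ Q p.1} := by
    simp only [Set.ofPred_and]
    exact (isClosed_le (by fun_prop) (by fun_prop)).inter
      ((isClosed_le (by fun_prop) (by fun_prop)).inter (isClosed_le (by fun_prop) hcs))
  convert isClosedMap_snd_of_compactSpace _ hT using 1
  ext R
  constructor
  · rintro ⟨ρ, hρ, h⟩
    exact ⟨(⟨ρ, (hK ρ).2 hρ⟩, R), h, rfl⟩
  · rintro ⟨⟨ρ, R'⟩, h, rfl⟩
    exact ⟨ρ, (hK ρ).1 ρ.2, h⟩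

lemma Achievable.mem_gaussRegion {P₁ P₂ Q : ℝ≥0} {R₁ R₂ : ℝ} (h : Achievable P₁ P₂ Q R₁ R₂) :
    (R₁, R₂) ∈ gaussRegion P₁ P₂ Q := by
  obtain ⟨-, -, N₁, N₂, c, hc, herr⟩ := h
  have hN : ∀ {M n : ℕ} {R : ℝ}, Real.exp (n * R) ≤ M → M ≠ 0 ∧ n * R ≤ Real.log M := by
    intro M n R h
    have hM : (0 : ℝ) < M := (Real.exp_pos _).trans_le h
    exact ⟨by rintro rfl; simp at hM, (Real.le_log_iff_exp_le hM).2 h⟩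
  have hε : Tendsto (fun n => ((c n).errorProb Q).toReal) atTop (𝓝 0) := by
    simpa [Function.comp_def] using (ENNReal.tendsto_toReal ENNReal.zero_ne_top).comp herr
  have hlim : ∀ R : ℝ, Tendsto (fun n : ℕ => (1 - ((c n).errorProb Q).toReal) * R - 1 / n) atTop
      (𝓝 R) := fun R => by
    simpa using (((tendsto_const_nhds (x := (1 : ℝ))).sub hε).mul_const R).sub
      (tendsto_one_div_atTop_nhds_zero_nat (𝕜 := ℝ))
  -- The pairs (1 − εₙ)R − 1/n lie in the region, each with its own ρ, and tend to R; 1/n absorbs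
  -- the lost nat. They may have negative entries, which `gaussRegion` allows.
  refine (isClosed_gaussRegion P₁ P₂ Q).mem_of_tendsto ((hlim R₁).prodMk_nhds (hlim R₂)) ?_
  filter_upwards [eventually_ne_atTop 0] with n hn
  obtain ⟨h₁, h₂, hp⟩ := hc n
  obtain ⟨hN₁, hl₁⟩ := hN h₁
  obtain ⟨hN₂, hl₂⟩ := hN h₂
  have : NeZero (N₁ n) := ⟨hN₁⟩
  have : NeZero (N₂ n) := ⟨hN₂⟩
  obtain ⟨ρ, hρ, b₁, b₂, b₃⟩ := (c n).exists_correlation hn hp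
  have hle : 0 ≤ 1 - ((c n).errorProb Q).toReal := by
    have : IsProbabilityMeasure (blockLaw n (N₁ n) (N₂ n) Q) := by
      unfold blockLaw
      infer_instance
    exact sub_nonneg.2 (measureReal_le_one (μ := blockLaw n (N₁ n) (N₂ n) Q))
  have hn0 : (0 : ℝ) < n := by exact_mod_cast Nat.pos_of_ne_zero hn
  have a₁ := mul_le_mul_of_nonneg_left hl₁ hle
  have a₂ := mul_le_mul_of_nonneg_left hl₂ hle
  have hinv : (n : ℝ) * (1 / n) = 1 := by field_simp
  refine ⟨ρ, hρ, ?_, ?_, ?_⟩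
  · refine le_of_mul_le_mul_left ?_ hn0
    rw [mul_sub, hinv]
    linarith
  · refine le_of_mul_le_mul_left ?_ hn0
    rw [mul_sub, hinv]
    linarith
  · refine le_of_mul_le_mul_left ?_ hn0
    rw [sumBound, mul_add, mul_sub, mul_sub, hinv]
    linarith

lemma capacityRegion_subset (P₁ P₂ Q : ℝ≥0) :
    capacityRegion P₁ P₂ Q ⊆ {R | 0 ≤ R.1 ∧ 0 ≤ R.2} ∩ gaussRegion P₁ P₂ Q :=
  closure_minimal (fun _ hR => ⟨⟨hR.1, hR.2.1⟩, hR.mem_gaussRegion⟩)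
    (((isClosed_le continuous_const continuous_fst).inter
      (isClosed_le continuous_const continuous_snd)).inter (isClosed_gaussRegion P₁ P₂ Q))

/-- The Gaussian inputs `X₁ = a S + N(0, τ)` and `X₂ ∼ N(0, P₂)`. -/
lemma mem_outerRegion_of_le {P₁ P₂ Q τ : ℝ≥0} {a : ℝ} {R : ℝ × ℝ} (h₁ : 0 ≤ R.1) (h₂ : 0 ≤ R.2)
    (hP : a ^ 2 * Q + τ ≤ P₁) (b₁ : R.1 ≤ Real.log (1 + τ) / 2) (b₂ : R.2 ≤ Real.log (1 + P₂) / 2)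
    (b₃ : R.1 + R.2 ≤ Real.log (1 + τ) / 2 + (Real.log (1 + τ + (a + 1) ^ 2 * Q + P₂) -
      Real.log (1 + τ + (a + 1) ^ 2 * Q)) / 2) : R ∈ outerRegion P₁ P₂ Q := by
  refine ⟨h₁, h₂, linKernel a τ, inferInstance, gaussianReal 0 P₂, inferInstance, ?_, ?_, ?_, ?_, ?_⟩
  · rw [lintegral_inp₁_sq]
    have : ‖a‖₊ ^ 2 * Q + τ ≤ P₁ := by
      rw [← NNReal.coe_le_coe]
      simpa using hP
    exact_mod_cast this
  · rw [lintegral_inp₂_sq]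
  · exact (ENNReal.ofReal_le_ofReal b₁).trans (le_condMutualInfo_inp₁ Q P₂ a τ)
  · exact (ENNReal.ofReal_le_ofReal b₂).trans (le_condMutualInfo_inp₂ Q P₂ a τ)
  · exact (ENNReal.ofReal_le_ofReal b₃).trans (ENNReal.ofReal_add_le.trans
      (add_le_add (le_condMutualInfo_inp₁ Q P₂ a τ) (le_mutualInfo_inp₂ Q P₂ a τ)))

lemma mem_outerRegion_of_mem_gaussRegion {P₁ P₂ Q : ℝ≥0} {R : ℝ × ℝ} (h₁ : 0 ≤ R.1)
    (h₂ : 0 ≤ R.2) (hR : R ∈ gaussRegion P₁ P₂ Q) : R ∈ outerRegion P₁ P₂ Q := by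
  obtain ⟨ρ, hρ, b₁, b₂, b₃⟩ := hR
  rw [sumBound] at b₃
  have hD : (0 : ℝ) < 1 + P₁ - ρ ^ 2 := by linarith
  have hDle : Real.log (1 + P₁ - ρ ^ 2) ≤ Real.log (1 + P₁) :=
    Real.log_le_log hD (by linarith [sq_nonneg ρ])
  rcases eq_or_ne Q 0 with rfl | hQ
  -- With S = 0 a correlation with T cannot be realized, but it does not help either: the last two
  -- logarithms of the sum bound no longer depend on ρ, and the first is largest at ρ = 0.
  · refine mem_outerRegion_of_le (a := 0) (τ := P₁) h₁ h₂ (by simp) (by linarith) b₂ ?_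
    simp only [NNReal.coe_zero, Real.sqrt_zero, add_zero, sub_add_cancel] at b₃
    simp only [NNReal.coe_zero, mul_zero, add_zero]
    linarith
  · have hQ0 : (0 : ℝ) < Q := NNReal.coe_pos.2 (pos_iff_ne_zero.2 hQ)
    -- The part ρT of X₁ is (ρ/√Q)S and spends power ρ²; τ is the power left for the part
    -- independent of S.
    obtain ⟨τ, hτ⟩ : ∃ τ : ℝ≥0, (τ : ℝ) = P₁ - ρ ^ 2 := ⟨⟨_, sub_nonneg.2 hρ⟩, rfl⟩
    have hs : √(Q : ℝ) ^ 2 = Q := Real.sq_sqrt hQ0.le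
    have hs0 : √(Q : ℝ) ≠ 0 := (Real.sqrt_pos.2 hQ0).ne'
    have ha : (ρ / √Q) ^ 2 * Q = ρ ^ 2 := by
      rw [div_pow, hs]
      field_simp
    have ha' : (ρ / √Q + 1) ^ 2 * Q = (ρ + √Q) ^ 2 := by
      nth_rewrite 2 [← hs]
      rw [← mul_pow, add_mul, div_mul_cancel₀ _ hs0, one_mul]
    have e : 1 + (τ : ℝ) = 1 + P₁ - ρ ^ 2 := by rw [hτ]; ring
    refine mem_outerRegion_of_le (a := ρ / √Q) (τ := τ) h₁ h₂ ?_ ?_ b₂ ?_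
    · rw [ha, hτ]
      linarith
    · rwa [e]
    · rw [e, ha']
      linarith

end Region

end DirtyMAC

end

/-- The capacity region of the dirty multiple-access channel without degraded message sets is
contained in the single-letter region. -/
theorem proposition1 (P₁ P₂ Q : NNReal) :
    DirtyMAC.capacityRegion P₁ P₂ Q ⊆ DirtyMAC.outerRegion P₁ P₂ Q := fun _ hR =>
  have h := DirtyMAC.capacityRegion_subset P₁ P₂ Q hR
  DirtyMAC.mem_outerRegion_of_mem_gaussRegion h.1.1 h.1.2 h.2
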